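/- Let $p>0$ and $a_k=k^{p-1}$ for $k\ge 1$. For $N\ge 1$ let $\Omega_N$ be the set of partitions $\eta=(n_1,\dots,n_N)$ of $N$ (integers $n_k\ge 0$ with $\sum_{k=1}^N k\,n_k=N$), let $$\mu_N(\eta)=\frac1{c_N}\prod_{k=1}^N\frac{a_k^{n_k}}{n_k!},\qquad c_N=\sum_{\eta\in\Omega_N}\prod_{k=1}^N\frac{a_k^{n_k}}{n_k!},$$ be the equilibrium probability measure on $\Omega_N$, and let $\nu_N(\eta)=n_1+\dots+n_N$ be the number of groups, so that $\mathbb P(\nu_N=n)=\mu_N(\{\eta:\nu_N(\eta)=n\})$. Put $$Q_p=p^{-1}\,\Gamma(p+1)^{\frac1{p+1}},\qquad d_p=\frac{Q_p}{p+1}.$$ **Theorem (local limit theorem for $\nu_N$).** For $$n=Q_pN^{\frac p{p+1}}+sN^{\frac p{2p+2}},\qquad s\in\mathbb R,\quad n\in\mathbb N,$$ one has $$\mathbb P(\nu_N=n)\sim f(N;s):=\frac1{\sqrt{2\pi d_p}}\,N^{-\frac p{2p+2}}\exp\Bigl(-\frac{s^2}{2d_p}\Bigr),\qquad N\to\infty,$$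 uniformly for $s$ in bounded sets: for all $K$ and $\varepsilon>0$ there is $N_0$ such that for every integer $N\ge N_0$, every $n\in\mathbb N$ and every real $s$ with $|s|\le K$ and $n=Q_pN^{p/(p+1)}+sN^{p/(2p+2)}$, $$\left|\frac{\mathbb P(\nu_N=n)}{f(N;s)}-1\right|<\varepsilon .$$ -/

import Mathlib

open scoped Nat

noncomputable section

namespace CoagFrag

/-- A state `η = (n_1, …, n_N)` with `∑ k * n_k = N` is a partition of `N`; the number `n_k` of
groups of size `k` is the multiplicity of `k` among the parts of `η`. -/
def groupsOfSize {N : ℕ} (η : N.Partition) (k : ℕ) : ℕ := η.parts.count k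

/-- The number of groups `ν_N(η) = n_1 + … + n_N`. -/
def numGroups {N : ℕ} (η : N.Partition) : ℕ := ∑ k ∈ Finset.Icc 1 N, groupsOfSize η k

/-- The unnormalized weight `∏ a_k ^ n_k / n_k!` of a state. -/
def weight (a : ℕ → ℝ) {N : ℕ} (η : N.Partition) : ℝ :=
  ∏ k ∈ Finset.Icc 1 N, a k ^ groupsOfSize η k / ((groupsOfSize η k)! : ℝ)

/-- The partition function `c_N`. -/
def partitionFunction (a : ℕ → ℝ) (N : ℕ) : ℝ := ∑ η : N.Partition, weight a η

/-- The mass `μ_N(η)` given to the state `η` by the equilibrium measure. -/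
def equilibriumMass (a : ℕ → ℝ) {N : ℕ} (η : N.Partition) : ℝ :=
  (partitionFunction a N)⁻¹ * weight a η

/-- `ℙ(ν_N = n)` under the equilibrium measure `μ_N`. -/
def probNumGroups (a : ℕ → ℝ) (N n : ℕ) : ℝ :=
  ∑ η : N.Partition with numGroups η = n, equilibriumMass a η

/-- `Q_p = p⁻¹ Γ(p+1)^(1/(p+1))`. -/
def Q (p : ℝ) : ℝ := p⁻¹ * Real.Gamma (p + 1) ^ (1 / (p + 1))

/-- `d_p = Q_p / (p+1)`. -/
def d (p : ℝ) : ℝ := Q p / (p + 1)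

/-- `f(N; s) = (2π d_p)^(-1/2) N^(-p/(2p+2)) exp(-s²/(2 d_p))`. -/
def localDensity (p : ℝ) (N : ℕ) (s : ℝ) : ℝ :=
  1 / √(2 * Real.pi * d p) * (N : ℝ) ^ (-(p / (2 * p + 2))) * Real.exp (-(s ^ 2 / (2 * d p)))

/-- The weights are positive for a positive parameter function. -/
theorem weight_pos {a : ℕ → ℝ} (ha : ∀ k, 1 ≤ k → 0 < a k) {N : ℕ} (η : N.Partition) :
    0 < weight a η := by
  refine Finset.prod_pos fun k hk => ?_
  have := ha k (Finset.mem_Icc.1 hk).1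
  positivity

/-- The equilibrium measure is a probability measure. -/
theorem sum_equilibriumMass {a : ℕ → ℝ} (ha : ∀ k, 1 ≤ k → 0 < a k) (N : ℕ) :
    ∑ η : N.Partition, equilibriumMass a η = 1 := by
  have h : 0 < partitionFunction a N :=
    Finset.sum_pos (fun η _ => weight_pos ha η) Finset.univ_nonempty
  simp only [equilibriumMass, ← Finset.mul_sum]
  exact inv_mul_cancel₀ h.ne'

end CoagFrag

end

/-!
With `S(z) = ∑_{k ≥ 1} k ^ (p - 1) e ^ (-k z)`, the total weight of the partitions of `N` with `n`
parts is the coefficient of `e ^ (-N z)` in `S(z) ^ n / n!`, and `c_N` is that coefficient in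
`exp S(z)`. Both are Fourier integrals over `z = σ - iθ`, `|θ| ≤ π` (`integral_genFun_pow`,
`integral_exp_genFun`), and both are evaluated by Laplace's method at the same explicit point
`σ = (Γ(p + 1) / N) ^ (1 / (p + 1))`, which is an approximate saddle point of `exp (S(z) + N z)`.

* `exists_abs_expSum_sub_le`: `∑_{k ≥ 1} k ^ (q - 1) e ^ (-k σ) = Γ(q) σ ^ (-q) + O(1)` for every
  `q > 0`. A bounded error is needed: the centring `Q_p N ^ (p / (p + 1)) = Γ(p) σ ^ (-p)` has to
  be right up to `o(σ ^ (-p / 2))`, which for large `p` is more than a comparison of the sum with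
  an integral gives. It comes from Poisson summation when `q > 1`, and from monotonicity when
  `q ≤ 1`. For `q = p, p + 1, p + 2, p + 3` it controls the Taylor coefficients of `S`.
* `exists_norm_genFun_le`: `|S(σ - iθ)| ≤ S(σ) - c σ ^ (-p) min(1, (θ / σ) ^ 2)` for `|θ| ≤ π`. Since
  `|S / n| ^ n ≤ exp (|S| - n)`, the normalized integrands of both integrals are bounded by
  `exp (|S(σ - iθ)| - S(σ))`, so this one estimate dominates both.
* `tendsto_integral_of_norm_le`: by dominated convergence on the scale `θ = σ ^ (1 + p / 2) u`, it
  suffices to know the pointwise limits of the integrands. For `c_N` the limit is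
  `exp (-Γ(p + 2) u ^ 2 / 2)`; if
  `(n - Γ(p) σ ^ (-p)) σ ^ (p / 2) → s`, then the integrand for `n` parts has the further factor
  `exp (-(i u Γ(p + 1) - s) ^ 2 / (2 Γ(p)))`, the second order term of `n log (S / n)`.

The quotient of the two Gaussian integrals and Stirling's formula for `n!` give the local limit
along any sequence whose rescaled deviation converges; uniformity for bounded `s` follows by
compactness.
-/

/-! ### Power sums `∑ k ^ (q - 1) e ^ (-k σ)` -/

namespace CoagFrag

open Real Filter Topology Asymptotics MeasureTheory Set
open scoped FourierTransform

/-- The power sum `∑_{k ≥ 1} k ^ (q - 1) e ^ (-k σ)`, indexed by `k - 1`. -/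
noncomputable def expSum (q σ : ℝ) : ℝ := ∑' k : ℕ, ((k : ℝ) + 1) ^ (q - 1) * exp (-σ * (k + 1))

theorem summable_expSum (q : ℝ) {σ : ℝ} (hσ : 0 < σ) :
    Summable fun k : ℕ => ((k : ℝ) + 1) ^ (q - 1) * exp (-σ * (k + 1)) := by
  have h1 : (fun x : ℝ => x ^ (q - 1) * exp (-σ * x)) =O[atTop] fun x : ℝ => x ^ (-2 : ℝ) := by
    have h := (isLittleO_exp_neg_mul_rpow_atTop hσ (-2 - (q - 1))).isBigO
    refine ((isBigO_refl (fun x : ℝ => x ^ (q - 1)) atTop).mul h).congr' EventuallyEq.rfl ?_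
    filter_upwards [eventually_gt_atTop 0] with x hx
    rw [← rpow_add hx]; congr 1; ring
  have h2 : Summable fun k : ℕ => ((k : ℝ) + 1) ^ (-2 : ℝ) := by
    have := (summable_nat_add_iff 1).2 (Real.summable_nat_rpow.2 (show (-2 : ℝ) < -1 by norm_num))
    simpa using this
  refine summable_of_isBigO_nat h2 ?_
  exact h1.comp_tendsto (tendsto_natCast_atTop_atTop.atTop_add tendsto_const_nhds)

theorem integral_rpow_mul_exp {q σ : ℝ} (hq : 0 < q) (hσ : 0 < σ) :
    ∫ x in Ioi (0 : ℝ), x ^ (q - 1) * exp (-σ * x) = Gamma q * σ ^ (-q) := by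
  have := Real.integral_rpow_mul_exp_neg_mul_Ioi hq hσ
  simp only [neg_mul]
  rw [this, one_div, inv_rpow hσ.le, rpow_neg hσ.le, mul_comm]

theorem integrableOn_rpow_mul_exp {q σ : ℝ} (hq : 0 < q) (hσ : 0 < σ) :
    IntegrableOn (fun x : ℝ => x ^ (q - 1) * exp (-σ * x)) (Ioi 0) := by
  have := integrableOn_rpow_mul_exp_neg_mul_rpow (p := 1) (s := q - 1) (b := σ) (by linarith)
    one_pos hσ
  simpa using this

/-- For `q ≤ 1` the summand is antitone, and the sum is compared with the integral. -/
theorem abs_expSum_sub_le_of_le_one {q : ℝ} (hq : 0 < q) (hq1 : q ≤ 1) {σ : ℝ} (hσ : 0 < σ) :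
    |expSum q σ - Gamma q * σ ^ (-q)| ≤ 1 + 1 / q := by
  set f : ℝ → ℝ := fun x => x ^ (q - 1) * exp (-σ * x) with hf
  have hint := integrableOn_rpow_mul_exp hq hσ
  have hint1 : IntegrableOn f (Ioi ((1 : ℕ) : ℝ)) := by
    refine hint.mono_set (Ioi_subset_Ioi (by norm_num))
  have hint01 : IntegrableOn f (Ioc (0 : ℝ) 1) := hint.mono_set Ioc_subset_Ioi_self
  have hanti : AntitoneOn f (Ici ((1 : ℕ) : ℝ)) := by
    intro x hx y hy hxy
    simp only [Nat.cast_one, mem_Ici] at hx hy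
    have h1 : y ^ (q - 1) ≤ x ^ (q - 1) :=
      rpow_le_rpow_of_nonpos (by linarith) hxy (by linarith)
    have h2 : exp (-σ * y) ≤ exp (-σ * x) := exp_le_exp.2 (by nlinarith)
    exact mul_le_mul h1 h2 (exp_nonneg _) (rpow_nonneg (by linarith) _)
  have hnn : ∀ t ∈ Ioi ((1 : ℕ) : ℝ), 0 ≤ f t := fun t ht => by
    simp only [Nat.cast_one, mem_Ioi] at ht
    have : 0 ≤ t := by linarith
    positivity
  have hsum := summable_expSum q hσ
  have hsum' : Summable fun n : ℕ => f n := by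
    rw [← summable_nat_add_iff 1]
    simpa [hf] using hsum
  have hlow := AntitoneOn.integral_le_tsum_comp_add 1 hanti hsum' hnn
  have hup := AntitoneOn.tsum_comp_add_le_integral 1 hanti hint1 hnn
  have hE : ∑' n : ℕ, f (n + 1 : ℕ) = expSum q σ := by simp [expSum, hf]
  have hE2 : expSum q σ = exp (-σ) + ∑' n : ℕ, f (n + 1 + 1 : ℕ) := by
    rw [← hE, ((summable_nat_add_iff 1).2 hsum').tsum_eq_zero_add]
    simp [hf]
  have hsplit : Gamma q * σ ^ (-q) = (∫ x in Ioc (0 : ℝ) 1, f x) + ∫ x in Ioi (1 : ℝ), f x := by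
    rw [← integral_rpow_mul_exp hq hσ, ← Ioc_union_Ioi_eq_Ioi (zero_le_one' ℝ),
      setIntegral_union (Ioc_disjoint_Ioi le_rfl) measurableSet_Ioi hint01
        (by simpa using hint1)]
  have hI0 : 0 ≤ ∫ x in Ioc (0 : ℝ) 1, f x := by
    refine setIntegral_nonneg measurableSet_Ioc fun x hx => ?_
    have : 0 ≤ x := hx.1.le
    positivity
  have hI1 : ∫ x in Ioc (0 : ℝ) 1, f x ≤ 1 / q := by
    have h1 : ∫ x in Ioc (0 : ℝ) 1, x ^ (q - 1) = 1 / q := by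
      rw [← intervalIntegral.integral_of_le zero_le_one, integral_rpow (Or.inl (by linarith))]
      simp [hq.ne']
    rw [← h1]
    refine setIntegral_mono_on hint01 ?_ measurableSet_Ioc fun x hx => ?_
    · have := (intervalIntegral.intervalIntegrable_rpow' (a := 0) (b := 1)
        (show -1 < q - 1 by linarith))
      rwa [intervalIntegrable_iff_integrableOn_Ioc_of_le zero_le_one] at this
    · have h2 : exp (-σ * x) ≤ 1 := exp_le_one_iff.2 (by nlinarith [hx.1])
      exact mul_le_of_le_one_right (rpow_nonneg hx.1.le _) h2
  have hexp : exp (-σ) ≤ 1 := exp_le_one_iff.2 (by linarith)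
  simp only [Nat.cast_one] at hlow hup
  rw [hE] at hlow
  have : 0 < 1 / q := by positivity
  rw [abs_le]
  constructor <;> linarith

/-- The Laplace transform of `x ^ (q - 1)` at a complex point, by analytic continuation from the
positive reals. -/
theorem integral_rpow_mul_cexp {q : ℝ} (hq : 0 < q) {r : ℂ} (hr : 0 < r.re) :
    ∫ x in Ioi (0 : ℝ), ((x ^ (q - 1) : ℝ) : ℂ) * Complex.exp (-r * x) =
      (1 / r) ^ (q : ℂ) * Complex.Gamma q := by
  set U : Set ℂ := {z | 0 < z.re} with hU
  have hUo : IsOpen U := isOpen_lt continuous_const Complex.continuous_re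
  have hUc : IsPreconnected U := (convex_halfSpace_re_gt 0).isPreconnected
  set F : ℂ → ℂ := fun z => ∫ x in Ioi (0 : ℝ), ((x ^ (q - 1) : ℝ) : ℂ) * Complex.exp (-z * x)
  have hmeas : ∀ (t : ℝ) (z : ℂ), AEStronglyMeasurable
      (fun x : ℝ => ((x ^ t : ℝ) : ℂ) * Complex.exp (-z * x)) (volume.restrict (Ioi 0)) := by
    intro t z
    refine ContinuousOn.aestronglyMeasurable (fun x hx => ?_) measurableSet_Ioi
    refine ContinuousAt.continuousWithinAt (ContinuousAt.mul ?_ (by fun_prop))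
    exact Complex.continuous_ofReal.continuousAt.comp
      (continuousAt_rpow_const _ _ (Or.inl (ne_of_gt hx)))
  have hnorm : ∀ (t : ℝ) (z : ℂ) (x : ℝ), 0 < x →
      ‖((x ^ t : ℝ) : ℂ) * Complex.exp (-z * x)‖ = x ^ t * exp (-z.re * x) := by
    intro t z x hx
    rw [norm_mul, Complex.norm_real, norm_of_nonneg (rpow_nonneg hx.le _), Complex.norm_exp]
    simp
  have hFdiff : DifferentiableOn ℂ F U := by
    intro z hz
    have hz0 : 0 < z.re := hz
    have hb : IntegrableOn (fun x : ℝ => x ^ (q + 1 - 1) * exp (-(z.re / 2) * x)) (Ioi 0) :=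
      integrableOn_rpow_mul_exp (by linarith) (by linarith)
    have hd := hasDerivAt_integral_of_dominated_loc_of_deriv_le (𝕜 := ℂ)
      (μ := volume.restrict (Ioi (0 : ℝ)))
      (F := fun (z : ℂ) (x : ℝ) => ((x ^ (q - 1) : ℝ) : ℂ) * Complex.exp (-z * x))
      (F' := fun (z : ℂ) (x : ℝ) => ((x ^ (q - 1) : ℝ) : ℂ) * (Complex.exp (-z * x) * (-1 * x)))
      (x₀ := z) (s := Metric.ball z (z.re / 2))
      (bound := fun x : ℝ => x ^ (q + 1 - 1) * exp (-(z.re / 2) * x))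
      (Metric.ball_mem_nhds z (by linarith))
      (Eventually.of_forall fun w => hmeas _ w) ?_ ?_ ?_ hb ?_
    · exact hd.2.differentiableAt.differentiableWithinAt
    · refine Integrable.mono' (integrableOn_rpow_mul_exp hq hz0) (hmeas _ z) ?_
      filter_upwards [ae_restrict_mem measurableSet_Ioi] with x hx
      exact (hnorm _ _ _ hx).le
    · have := (hmeas (q - 1) z).mul
        (Complex.measurable_ofReal.aestronglyMeasurable (μ := volume.restrict (Ioi (0 : ℝ)))).neg
      refine this.congr (Eventually.of_forall fun x => ?_)
      simp only [Pi.mul_apply, Pi.neg_apply]; ring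
    · filter_upwards [ae_restrict_mem measurableSet_Ioi] with x hx w hw
      have hx0 : 0 < x := hx
      have hw' : z.re / 2 ≤ w.re := by
        have h1 : |(w - z).re| ≤ ‖w - z‖ := Complex.abs_re_le_norm _
        have h2 : ‖w - z‖ < z.re / 2 := by simpa [dist_eq_norm] using hw
        rw [Complex.sub_re] at h1
        linarith [neg_abs_le (w.re - z.re)]
      have : ((x ^ (q - 1) : ℝ) : ℂ) * (Complex.exp (-w * x) * (-1 * x)) =
          -(((x ^ (q + 1 - 1) : ℝ) : ℂ) * Complex.exp (-w * x)) := by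
        rw [show q + 1 - 1 = (q - 1) + 1 by ring, rpow_add hx0, rpow_one]
        push_cast; ring
      rw [this, norm_neg, hnorm _ _ _ hx0]
      refine mul_le_mul_of_nonneg_left (exp_le_exp.2 ?_) (rpow_nonneg hx0.le _)
      nlinarith
    · filter_upwards with x w hw
      exact ((((hasDerivAt_id w).neg.mul_const (x : ℂ)).cexp).const_mul _)
  have hGdiff : DifferentiableOn ℂ (fun z : ℂ => (1 / z) ^ (q : ℂ) * Complex.Gamma q) U := by
    intro z hz
    have hz0 : z ≠ 0 := fun h => by simp [hU, h] at hz
    refine (DifferentiableAt.mul_const (DifferentiableAt.cpow_const ?_ ?_) _).differentiableWithinAt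
    · exact (differentiableAt_const _).div differentiableAt_id hz0
    · left
      have hz' : 0 < z.re := hz
      have h2 : 0 < Complex.normSq z := Complex.normSq_pos.2 hz0
      simpa using div_pos hz' h2
  have hreal : ∀ s : ℝ, 0 < s → F s = (1 / (s : ℂ)) ^ (q : ℂ) * Complex.Gamma q := by
    intro s hs
    rw [← Complex.integral_cpow_mul_exp_neg_mul_Ioi (a := q) (by simpa using hq) hs]
    refine setIntegral_congr_fun measurableSet_Ioi fun x hx => ?_
    have hx0 : 0 < x := hx
    rw [Complex.ofReal_cpow hx0.le]
    push_cast
    rw [neg_mul]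
  refine AnalyticOnNhd.eqOn_of_preconnected_of_frequently_eq (hFdiff.analyticOnNhd hUo)
    (hGdiff.analyticOnNhd hUo) hUc (z₀ := 1) (by simp [hU]) ?_ hr
  -- the two sides agree on the real points `1 + 1 / (n + 1)`, which accumulate at `1`
  have ht : Tendsto (fun n : ℕ => ((1 + 1 / ((n : ℝ) + 1) : ℝ) : ℂ)) atTop (𝓝[≠] 1) := by
    refine tendsto_nhdsWithin_iff.2 ⟨?_, Eventually.of_forall fun n => ?_⟩
    · have := (tendsto_one_div_add_atTop_nhds_zero_nat (𝕜 := ℝ)).const_add 1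
      rw [add_zero] at this
      exact_mod_cast (Complex.continuous_ofReal.tendsto 1).comp this
    · have : (0 : ℝ) < 1 / ((n : ℝ) + 1) := by positivity
      simp only [mem_compl_iff, mem_singleton_iff]
      intro h
      have h' : (1 + 1 / ((n : ℝ) + 1) : ℝ) = 1 := by exact_mod_cast h
      linarith
  exact ht.frequently (Frequently.of_forall fun n => hreal _ (by positivity))

/-- For `q > 1`, Poisson summation turns the sum into `∑_m Γ(q) (σ + 2πim) ^ (-q)`; the term
`m = 0` is the main term and the other terms are bounded uniformly in `σ`. -/
theorem exists_abs_expSum_sub_le_of_one_lt {q : ℝ} (hq : 1 < q) :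
    ∃ C, ∀ σ : ℝ, 0 < σ → |expSum q σ - Gamma q * σ ^ (-q)| ≤ C := by
  refine ⟨∑' n : ℤ, Gamma q * |(n : ℝ)| ^ (-q), fun σ hσ => ?_⟩
  have hq0 : 0 < q := by linarith
  have hG : 0 < Gamma q := Gamma_pos_of_pos hq0
  -- `max x 0` makes the summand vanish for `x ≤ 0`, so that the sum over `ℤ` is `expSum`; it is
  -- continuous at `0` because `q > 1`
  set f : ℝ → ℂ := fun x => (((max x 0) ^ (q - 1) * exp (-σ * x) : ℝ) : ℂ) with hf
  have hcont : Continuous f := by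
    refine Complex.continuous_ofReal.comp (Continuous.mul ?_ (by fun_prop))
    exact (continuous_id.max continuous_const).rpow_const fun x => Or.inr (by linarith)
  have hF : ∀ w : ℝ, 𝓕 f w = (1 / (σ + 2 * π * w * Complex.I)) ^ (q : ℂ) * Complex.Gamma q := by
    intro w
    rw [Real.fourier_real_eq_integral_exp_smul]
    have hz : ∀ v ∈ (Ioi (0 : ℝ))ᶜ,
        Complex.exp (((-2 * π * v * w : ℝ) : ℂ) * Complex.I) • f v = 0 := by
      intro v hv
      have : max v 0 = 0 := max_eq_right (by simpa using hv)
      simp [hf, this, zero_rpow (show q - 1 ≠ 0 by linarith)]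
    rw [← setIntegral_eq_integral_of_forall_compl_eq_zero (s := Ioi (0 : ℝ)) (by
      intro v hv; exact hz v hv)]
    rw [← integral_rpow_mul_cexp hq0 (by simpa using hσ)]
    refine setIntegral_congr_fun measurableSet_Ioi fun v hv => ?_
    have hv0 : 0 < v := hv
    simp only [hf, smul_eq_mul, max_eq_left hv0.le]
    push_cast
    rw [mul_left_comm, ← Complex.exp_add]
    congr 2
    ring
  have hFn : ∀ w : ℝ, w ≠ 0 → ‖𝓕 f w‖ ≤ Gamma q * |w| ^ (-q) := by
    intro w hw
    rw [hF, norm_mul, Complex.Gamma_ofReal, Complex.norm_real, norm_of_nonneg hG.le, mul_comm,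
      Complex.norm_cpow_real]
    refine mul_le_mul_of_nonneg_left ?_ hG.le
    rw [rpow_neg (abs_nonneg w), ← inv_rpow (abs_nonneg w)]
    refine rpow_le_rpow (norm_nonneg _) ?_ hq0.le
    rw [norm_div, norm_one, one_div]
    have hw' : 0 < |w| := abs_pos.2 hw
    refine inv_anti₀ hw' ?_
    refine le_trans ?_ (Complex.abs_im_le_norm _)
    have : ((σ : ℂ) + 2 * π * w * Complex.I).im = 2 * π * w := by
      simp
    rw [this, abs_mul, abs_of_pos (by positivity : (0 : ℝ) < 2 * π)]
    nlinarith [pi_gt_three]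
  have hFO : 𝓕 f =O[cocompact ℝ] (|·| ^ (-q)) := by
    refine IsBigO.of_bound (Gamma q) ?_
    have : ∀ᶠ w : ℝ in cocompact ℝ, w ≠ 0 := by
      have := (isCompact_singleton (x := (0 : ℝ))).compl_mem_cocompact
      filter_upwards [this] with w hw using hw
    filter_upwards [this] with w hw
    rw [norm_of_nonneg (rpow_nonneg (abs_nonneg w) _)]
    exact hFn w hw
  have hfO : f =O[cocompact ℝ] (|·| ^ (-q)) := by
    rw [cocompact_eq_atBot_atTop, isBigO_sup]
    constructor
    · refine (isBigO_zero _ _).congr' ?_ EventuallyEq.rfl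
      filter_upwards [eventually_le_atBot 0] with x hx
      simp [hf, max_eq_right hx, zero_rpow (show q - 1 ≠ 0 by linarith)]
    · have h := (isLittleO_exp_neg_mul_rpow_atTop hσ (-q - (q - 1))).isBigO
      have h' := (isBigO_refl (fun x : ℝ => x ^ (q - 1)) atTop).mul h
      refine IsBigO.of_norm_left (h'.norm_left.congr' ?_ ?_)
      · filter_upwards [eventually_gt_atTop 0] with x hx
        simp only [hf, max_eq_left hx.le, Complex.norm_real]
      · filter_upwards [eventually_gt_atTop 0] with x hx
        rw [← rpow_add hx, abs_of_pos hx]; congr 1; ring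
  have hP := Real.tsum_eq_tsum_fourier_of_rpow_decay hcont hq hfO hFO 0
  have hL : ∑' n : ℤ, f (0 + n) = (expSum q σ : ℂ) := by
    have hinj : Function.Injective fun k : ℕ => ((k : ℤ) + 1) := fun a b h => by simpa using h
    rw [expSum, Complex.ofReal_tsum, ← hinj.tsum_eq]
    · refine tsum_congr fun k => ?_
      have : (0 : ℝ) ≤ (k : ℝ) + 1 := by positivity
      simp [hf, max_eq_left this]
    · intro n hn
      by_contra hc
      apply hn
      have : (n : ℝ) ≤ 0 := by
        have : n ≤ 0 := by
          by_contra h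
          exact hc ⟨(n - 1).toNat, by simp; omega⟩
        exact_mod_cast this
      simp [hf, max_eq_right this, zero_rpow (show q - 1 ≠ 0 by linarith)]
  have hR : ∀ n : ℤ, 𝓕 f n * fourier n ((0 : ℝ) : UnitAddCircle) = 𝓕 f n := fun n => by
    simp
  simp only [hR] at hP
  have hsum : Summable fun n : ℤ => 𝓕 f n :=
    summable_of_isBigO (Real.summable_abs_int_rpow hq) (hFO.comp_tendsto Int.tendsto_coe_cofinite)
  have hmain : 𝓕 f ((0 : ℤ) : ℝ) = ((Gamma q * σ ^ (-q) : ℝ) : ℂ) := by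
    rw [hF]
    push_cast
    rw [Complex.ofReal_cpow hσ.le, Complex.Gamma_ofReal, mul_comm]
    simp only [mul_zero, zero_mul, add_zero, one_div]
    rw [Complex.inv_cpow _ _ (by rw [Complex.arg_ofReal_of_nonneg hσ.le]; exact pi_pos.ne)]
    push_cast
    rw [Complex.cpow_neg]
  rw [hL, hsum.tsum_eq_add_tsum_ite 0, hmain] at hP
  have h2 : ‖∑' n : ℤ, if n = 0 then (0 : ℂ) else 𝓕 f n‖ ≤
      ∑' n : ℤ, Gamma q * |(n : ℝ)| ^ (-q) := by
    refine tsum_of_norm_bounded ((Real.summable_abs_int_rpow hq).mul_left _).hasSum fun n => ?_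
    split_ifs with h
    · simp only [norm_zero]; positivity
    · exact hFn n (by exact_mod_cast h)
  rw [← norm_eq_abs, ← Complex.norm_real, Complex.ofReal_sub, hP, add_sub_cancel_left]
  exact h2

theorem exists_abs_expSum_sub_le {q : ℝ} (hq : 0 < q) :
    ∃ C, ∀ σ : ℝ, 0 < σ → |expSum q σ - Gamma q * σ ^ (-q)| ≤ C := by
  rcases le_or_gt q 1 with h | h
  · exact ⟨_, fun σ hσ => abs_expSum_sub_le_of_le_one hq h hσ⟩
  · exact exists_abs_expSum_sub_le_of_one_lt h

end CoagFrag

/-! ### Cauchy's formula for partitions with a given number of parts -/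

namespace CoagFrag

open Filter Topology MeasureTheory Finset

/-- Partitions of `N` with `n` parts, encoded by their multiplicity functions on `{1, …, M}`. -/
theorem sum_weight_eq_sum_piAntidiag (a : ℕ → ℝ) {N M : ℕ} (hNM : N ≤ M) (n : ℕ) :
    ∑ η : N.Partition with numGroups η = n, weight a η =
      ∑ κ ∈ piAntidiag (Icc 1 M) n with ∑ i ∈ Icc 1 M, i * κ i = N,
        ∏ i ∈ Icc 1 M, a i ^ κ i / ((κ i)! : ℝ) := by
  have hsub : Icc 1 N ⊆ Icc 1 M := Icc_subset_Icc le_rfl hNM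
  have hzero : ∀ (η : N.Partition) (i : ℕ), i ∉ Icc 1 N → η.parts.count i = 0 := by
    intro η i hi
    refine Multiset.count_eq_zero.2 fun h => hi ?_
    exact mem_Icc.2 ⟨η.parts_pos h, Nat.Partition.le_of_mem_parts h⟩
  refine sum_bij (fun η _ i => η.parts.count i) ?_ ?_ ?_ ?_
  · intro η hη
    simp only [mem_filter, mem_univ, true_and] at hη
    simp only [mem_filter, mem_piAntidiag]
    refine ⟨⟨?_, fun i hi => ?_⟩, ?_⟩
    · rw [← hη, numGroups]
      exact (sum_subset hsub fun i _ hi => hzero η i hi).symm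
    · by_contra h
      exact hi (hzero η i fun h' => h (hsub h'))
    · conv_rhs => rw [← η.parts_sum, sum_multiset_count]
      simp only [smul_eq_mul, mul_comm]
      refine (sum_subset ?_ fun i _ hi => ?_).symm
      · intro i hi
        by_contra h
        rw [Multiset.mem_toFinset, ← Multiset.count_pos, hzero η i fun h' => h (hsub h')] at hi
        exact lt_irrefl _ hi
      · rw [Multiset.mem_toFinset] at hi
        simp [Multiset.count_eq_zero.2 hi]
  · intro η _ η' _ h
    refine Nat.Partition.ext (Multiset.ext.2 fun i => congrFun h i)
  · intro κ hκ
    simp only [mem_filter, mem_piAntidiag] at hκ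
    obtain ⟨⟨h1, h2⟩, h3⟩ := hκ
    have hcount : ∀ i, (∑ j ∈ Icc 1 M, κ j • ({j} : Multiset ℕ)).count i = κ i := by
      intro i
      rw [Multiset.count_sum']
      simp only [Multiset.count_nsmul, Multiset.count_singleton, mul_ite, mul_one, mul_zero]
      rw [Finset.sum_ite_eq]
      split_ifs with h
      · rfl
      · by_contra h'
        exact h (h2 i fun h0 => h' h0.symm)
    let η : N.Partition :=
      { parts := ∑ j ∈ Icc 1 M, κ j • ({j} : Multiset ℕ)
        parts_pos := by
          intro i hi
          rw [← Multiset.count_pos, hcount] at hi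
          exact (mem_Icc.1 (h2 i hi.ne')).1
        parts_sum := by
          rw [← h3, ← Multiset.coe_sumAddMonoidHom, map_sum]
          refine sum_congr rfl fun i _ => ?_
          rw [Multiset.coe_sumAddMonoidHom, Multiset.sum_nsmul, Multiset.sum_singleton, smul_eq_mul,
            mul_comm] }
    refine ⟨η, ?_, funext hcount⟩
    refine mem_filter.2 ⟨mem_univ _, ?_⟩
    rw [← h1, ← sum_subset hsub fun i _ hi => ?_]
    · exact sum_congr rfl fun i _ => hcount i
    · rw [← hcount i]; exact hzero η i hi
  · intro η _
    refine prod_subset hsub fun i _ hi => ?_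
    rw [groupsOfSize, hzero η i hi]; simp

/-- Multinomial expansion of `(∑ f i) ^ n / n!`. -/
theorem sum_pow_div_factorial (s : Finset ℕ) (f : ℕ → ℂ) (n : ℕ) :
    (∑ i ∈ s, f i) ^ n / (n ! : ℂ) = ∑ κ ∈ piAntidiag s n, ∏ i ∈ s, f i ^ κ i / ((κ i)! : ℂ) := by
  rw [sum_pow_eq_sum_piAntidiag, sum_div]
  refine sum_congr rfl fun κ hκ => ?_
  have h1 := Nat.multinomial_spec s κ
  rw [(mem_piAntidiag.1 hκ).1] at h1
  have h2 : ((n ! : ℕ) : ℂ) = (∏ i ∈ s, ((κ i)! : ℂ)) * (Nat.multinomial s κ : ℂ) := by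
    rw [← h1]; push_cast; rfl
  have h3 : (∏ i ∈ s, ((κ i)! : ℂ)) ≠ 0 := prod_ne_zero_iff.2 fun i _ => by
    exact_mod_cast Nat.factorial_ne_zero _
  have h4 : (Nat.multinomial s κ : ℂ) ≠ 0 := by exact_mod_cast (Nat.multinomial_pos s κ).ne'
  rw [prod_div_distrib, h2]
  field_simp

theorem integral_cexp_int (m : ℤ) :
    ∫ θ in (-Real.pi)..Real.pi, Complex.exp (m * Complex.I * θ) =
      if m = 0 then (2 * Real.pi : ℂ) else 0 := by
  split_ifs with h
  · subst h; simp; ring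
  · have hm : (m : ℂ) * Complex.I ≠ 0 := mul_ne_zero (by exact_mod_cast h) Complex.I_ne_zero
    rw [integral_exp_mul_complex hm]
    have : Complex.exp (m * Complex.I * (Real.pi : ℝ)) =
        Complex.exp (m * Complex.I * ((-Real.pi : ℝ) : ℂ)) := by
      rw [Complex.exp_eq_exp_iff_exists_int]
      exact ⟨m, by push_cast; ring⟩
    rw [this, sub_self, zero_div]

/-- The generating function `∑_{k ≥ 1} a_k e ^ (-k z)`. -/
noncomputable def genFun (a : ℕ → ℝ) (z : ℂ) : ℂ :=
  ∑' k : ℕ, (a (k + 1) : ℂ) * Complex.exp (-z * (k + 1))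

theorem integral_truncation_pow (a : ℕ → ℝ) {N M : ℕ} (hNM : N ≤ M) (n : ℕ) (σ : ℝ) :
    ∫ θ in (-Real.pi)..Real.pi,
      (∑ k ∈ range M, (a (k + 1) : ℂ) * Complex.exp (-(σ - θ * Complex.I) * (k + 1))) ^ n
        / (n ! : ℂ) * Complex.exp (-(N * Complex.I * θ)) =
      2 * Real.pi * Real.exp (-(N * σ)) *
        ((∑ η : N.Partition with numGroups η = n, weight a η : ℝ) : ℂ) := by
  have hre : ∀ θ : ℝ, ∑ k ∈ range M, (a (k + 1) : ℂ) * Complex.exp (-(σ - θ * Complex.I) * (k + 1))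
      = ∑ i ∈ Icc 1 M, (a i : ℂ) * Complex.exp (-(σ - θ * Complex.I) * i) := by
    intro θ
    have h := sum_Ico_add' (fun i : ℕ => (a i : ℂ) * Complex.exp (-(σ - θ * Complex.I) * i)) 0 M 1
    rw [← range_eq_Ico, zero_add] at h
    rw [show Icc 1 M = Ico 1 (M + 1) from rfl, ← h]
    exact sum_congr rfl fun k _ => by push_cast; rfl
  have hexp : ∀ θ : ℝ, (∑ k ∈ range M, (a (k + 1) : ℂ) *
      Complex.exp (-(σ - θ * Complex.I) * (k + 1))) ^ n / (n ! : ℂ)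
        * Complex.exp (-(N * Complex.I * θ)) =
      ∑ κ ∈ piAntidiag (Icc 1 M) n, ((∏ i ∈ Icc 1 M, (a i : ℂ) ^ κ i / ((κ i)! : ℂ)) *
        Complex.exp (-(σ * (∑ i ∈ Icc 1 M, i * κ i : ℕ)))) *
        Complex.exp ((((∑ i ∈ Icc 1 M, i * κ i : ℕ) : ℤ) - N : ℤ) * Complex.I * θ) := by
    intro θ
    rw [hre, sum_pow_div_factorial, sum_mul]
    refine sum_congr rfl fun κ _ => ?_
    have : ∀ i, ((a i : ℂ) * Complex.exp (-(σ - θ * Complex.I) * i)) ^ κ i / ((κ i)! : ℂ) =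
        (a i : ℂ) ^ κ i / ((κ i)! : ℂ) * Complex.exp (-(σ - θ * Complex.I) * (i * κ i : ℕ)) := by
      intro i
      rw [mul_pow, ← Complex.exp_nat_mul, mul_div_right_comm]
      congr 2
      push_cast; ring
    simp only [this]
    rw [prod_mul_distrib, ← Complex.exp_sum, ← mul_sum, mul_assoc, mul_assoc (∏ i ∈ Icc 1 M, _),
      ← Complex.exp_add, ← Complex.exp_add]
    congr 2
    push_cast; ring
  simp only [hexp]
  rw [intervalIntegral.integral_finsetSum fun κ _ =>
    Continuous.intervalIntegrable (by fun_prop) _ _]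
  simp only [intervalIntegral.integral_const_mul, integral_cexp_int]
  rw [sum_weight_eq_sum_piAntidiag a hNM, sum_filter]
  push_cast
  rw [mul_sum]
  refine sum_congr rfl fun κ _ => ?_
  by_cases h : ∑ i ∈ Icc 1 M, i * κ i = N
  · have h' : ∑ i ∈ Icc 1 M, (i : ℂ) * (κ i : ℂ) = N := by exact_mod_cast h
    have h'' : ∑ i ∈ Icc 1 M, (i : ℤ) * (κ i : ℤ) = N := by exact_mod_cast h
    simp only [h, h', h'', sub_self, if_true]
    push_cast
    rw [mul_comm (σ : ℂ)]; ring
  · have h'' : ¬ ∑ i ∈ Icc 1 M, (i : ℤ) * (κ i : ℤ) = N := by exact_mod_cast h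
    simp [h, sub_eq_zero, h'']

theorem genFun_term_norm (a : ℕ → ℝ) (ha : ∀ k, 1 ≤ k → 0 < a k) (σ θ : ℝ) (k : ℕ) :
    ‖(a (k + 1) : ℂ) * Complex.exp (-(σ - θ * Complex.I) * (k + 1))‖ =
      a (k + 1) * Real.exp (-σ * (k + 1)) := by
  rw [norm_mul, Complex.norm_real, Real.norm_of_nonneg (ha _ (by simp)).le, Complex.norm_exp]
  simp

theorem continuous_genFun (a : ℕ → ℝ) (ha : ∀ k, 1 ≤ k → 0 < a k) {σ : ℝ}
    (hs : Summable fun k : ℕ => a (k + 1) * Real.exp (-σ * (k + 1))) :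
    Continuous fun θ : ℝ => genFun a (σ - θ * Complex.I) :=
  continuous_tsum (fun k => by fun_prop) hs fun k θ => (genFun_term_norm a ha σ θ k).le

theorem norm_genFun_le (a : ℕ → ℝ) (ha : ∀ k, 1 ≤ k → 0 < a k) {σ : ℝ}
    (hs : Summable fun k : ℕ => a (k + 1) * Real.exp (-σ * (k + 1))) (θ : ℝ) :
    ‖genFun a (σ - θ * Complex.I)‖ ≤ ∑' k : ℕ, a (k + 1) * Real.exp (-σ * (k + 1)) :=
  tsum_of_norm_bounded hs.hasSum fun k => (genFun_term_norm a ha σ θ k).le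

/-- Cauchy's formula for the weight of the partitions with `n` parts. -/
theorem integral_genFun_pow (a : ℕ → ℝ) (ha : ∀ k, 1 ≤ k → 0 < a k) {σ : ℝ}
    (hs : Summable fun k : ℕ => a (k + 1) * Real.exp (-σ * (k + 1))) (N n : ℕ) :
    ∫ θ in (-Real.pi)..Real.pi, genFun a (σ - θ * Complex.I) ^ n / (n ! : ℂ)
        * Complex.exp (-(N * Complex.I * θ)) =
      2 * Real.pi * Real.exp (-(N * σ)) *
        ((∑ η : N.Partition with numGroups η = n, weight a η : ℝ) : ℂ) := by
  set B := ∑' k : ℕ, a (k + 1) * Real.exp (-σ * (k + 1))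
  have hnn : ∀ k : ℕ, 0 ≤ a (k + 1) * Real.exp (-σ * (k + 1)) := fun k =>
    mul_nonneg (ha _ (by simp)).le (Real.exp_nonneg _)
  have hlim := intervalIntegral.tendsto_integral_filter_of_dominated_convergence
    (l := atTop) (μ := volume) (a := -Real.pi) (b := Real.pi)
    (F := fun (M : ℕ) (θ : ℝ) => (∑ k ∈ range M, (a (k + 1) : ℂ) *
      Complex.exp (-(σ - θ * Complex.I) * (k + 1))) ^ n / (n ! : ℂ)
        * Complex.exp (-(N * Complex.I * θ)))
    (f := fun θ : ℝ => genFun a (σ - θ * Complex.I) ^ n / (n ! : ℂ)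
        * Complex.exp (-(N * Complex.I * θ))) (fun _ => B ^ n / (n ! : ℝ))
    (Eventually.of_forall fun M => Continuous.aestronglyMeasurable (by fun_prop))
    (Eventually.of_forall fun M => Eventually.of_forall fun θ _ => ?_)
    intervalIntegrable_const
    (Eventually.of_forall fun θ _ => ?_)
  · refine tendsto_nhds_unique hlim (tendsto_const_nhds.congr' ?_)
    filter_upwards [eventually_ge_atTop N] with M hM
    exact (integral_truncation_pow a hM n σ).symm
  · have h1 : ‖Complex.exp (-(N * Complex.I * θ))‖ = 1 := by
      rw [Complex.norm_exp]; simp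
    rw [norm_mul, h1, mul_one, norm_div, norm_pow, Complex.norm_natCast]
    gcongr
    refine (norm_sum_le _ _).trans ?_
    simp only [genFun_term_norm a ha]
    exact hs.sum_le_tsum _ fun k _ => hnn k
  · refine ((Tendsto.pow ?_ n).div_const _).mul_const _
    have : Summable fun k : ℕ => (a (k + 1) : ℂ) * Complex.exp (-(σ - θ * Complex.I) * (k + 1)) :=
      Summable.of_norm (by simpa only [genFun_term_norm a ha] using hs)
    exact this.hasSum.tendsto_sum_nat

theorem numGroups_le {N : ℕ} (η : N.Partition) : numGroups η ≤ N := by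
  have h := η.parts_sum
  rw [sum_multiset_count] at h
  calc numGroups η = ∑ i ∈ Icc 1 N, η.parts.count i := rfl
    _ ≤ ∑ i ∈ η.parts.toFinset, η.parts.count i := by
        refine sum_le_sum_of_ne_zero fun i _ hi => ?_
        exact Multiset.mem_toFinset.2 (Multiset.count_ne_zero.1 hi)
    _ ≤ ∑ i ∈ η.parts.toFinset, η.parts.count i • i := by
        refine sum_le_sum fun i hi => ?_
        rw [smul_eq_mul]
        exact Nat.le_mul_of_pos_right _ (η.parts_pos (Multiset.mem_toFinset.1 hi))
    _ = N := h

/-- Cauchy's formula for the partition function, by summation over the number of parts. -/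
theorem integral_exp_genFun (a : ℕ → ℝ) (ha : ∀ k, 1 ≤ k → 0 < a k) {σ : ℝ}
    (hs : Summable fun k : ℕ => a (k + 1) * Real.exp (-σ * (k + 1))) (N : ℕ) :
    ∫ θ in (-Real.pi)..Real.pi, Complex.exp (genFun a (σ - θ * Complex.I))
        * Complex.exp (-(N * Complex.I * θ)) =
      2 * Real.pi * Real.exp (-(N * σ)) * (partitionFunction a N : ℂ) := by
  set B := ∑' k : ℕ, a (k + 1) * Real.exp (-σ * (k + 1))
  have hcont := continuous_genFun a ha hs
  have hsum := intervalIntegral.hasSum_integral_of_dominated_convergence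
    (μ := volume) (a := -Real.pi) (b := Real.pi)
    (F := fun (n : ℕ) (θ : ℝ) => genFun a (σ - θ * Complex.I) ^ n / (n ! : ℂ)
        * Complex.exp (-(N * Complex.I * θ)))
    (f := fun θ : ℝ => Complex.exp (genFun a (σ - θ * Complex.I))
        * Complex.exp (-(N * Complex.I * θ))) (fun n _ => B ^ n / (n ! : ℝ))
    (fun n => Continuous.aestronglyMeasurable (by fun_prop))
    (fun n => Eventually.of_forall fun θ _ => ?_)
    (Eventually.of_forall fun θ _ => Real.summable_pow_div_factorial B)
    intervalIntegrable_const
    (Eventually.of_forall fun θ _ => ?_)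
  · rw [← hsum.tsum_eq]
    simp only [integral_genFun_pow a ha hs]
    rw [tsum_mul_left]
    congr 1
    rw [tsum_eq_sum (s := range (N + 1))]
    · rw [← Complex.ofReal_sum]
      congr 1
      exact (sum_fiberwise_of_maps_to (fun η _ => mem_range.2 (Nat.lt_succ_of_le (numGroups_le η)))
        _)
    · intro n hn
      rw [sum_eq_zero, Complex.ofReal_zero]
      intro η hη
      exfalso
      have := numGroups_le η
      rw [(mem_filter.1 hη).2] at this
      exact hn (mem_range.2 (Nat.lt_succ_of_le this))
  · have h1 : ‖Complex.exp (-(N * Complex.I * θ))‖ = 1 := by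
      rw [Complex.norm_exp]; simp
    rw [norm_mul, h1, mul_one, norm_div, norm_pow, Complex.norm_natCast]
    gcongr
    exact norm_genFun_le a ha hs θ
  · refine HasSum.mul_right _ ?_
    rw [Complex.exp_eq_exp_ℂ]
    exact NormedSpace.expSeries_div_hasSum_exp _

end CoagFrag

/-! ### Decay of the generating function off the real axis -/

namespace CoagFrag

open Filter Topology MeasureTheory Finset

theorem norm_one_add_cexp (y : ℝ) :
    ‖1 + Complex.exp (2 * y * Complex.I)‖ = 2 * |Real.cos y| := by
  have : 1 + Complex.exp (2 * y * Complex.I) =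
      2 * (Real.cos y : ℂ) * Complex.exp (y * Complex.I) := by
    rw [Complex.ofReal_cos, Complex.cos, mul_div_cancel₀ _ (two_ne_zero), add_mul,
      ← Complex.exp_add, ← Complex.exp_add, neg_mul, neg_add_cancel, Complex.exp_zero, add_comm]
    congr 2; ring
  rw [this, norm_mul, norm_mul, Complex.norm_exp_ofReal_mul_I, Complex.norm_real]
  simp

theorem hasSum_ite_mem {E : Type*} [AddCommMonoid E] [TopologicalSpace E] (B : Finset ℕ)
    (g : ℕ → E) : HasSum (fun k => if k ∈ B then g k else 0) (∑ k ∈ B, g k) := by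
  rw [← sum_congr rfl fun k hk => if_pos hk]
  exact hasSum_sum_of_ne_finset_zero fun k hk => if_neg hk

/-- A trigonometric series with nonnegative coefficients that are at least `δ` on `[M, 3M)`
is smaller than its value at `0`: the frequencies `j` and `j + m` are paired, and each pair loses
the factor `|cos (m θ / 2)|`. -/
theorem norm_tsum_le_sub {b : ℕ → ℝ} (hb : ∀ k, 0 ≤ b k) (hs : Summable b) {δ : ℝ}
    (hδ : 0 ≤ δ) {M m : ℕ} (hm : m ≤ M) (hw : ∀ k ∈ Ico M (3 * M), δ ≤ b k) {e : ℕ → ℂ} {y : ℝ}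
    (he : ∀ k, ‖e k‖ = 1) (hem : ∀ k, e (k + m) = e k * Complex.exp (2 * y * Complex.I)) :
    ‖∑' k, (b k : ℂ) * e k‖ ≤ ∑' k, b k - δ * M * (1 - |Real.cos y|) := by
  set A := Ico M (2 * M)
  set A' := Ico (M + m) (2 * M + m)
  -- the part of the coefficients that is used for the pairs; `A` and `A'` may overlap, and then
  -- the two halves add up to `δ`
  set w : ℕ → ℝ := fun k => (if k ∈ A then δ / 2 else 0) + (if k ∈ A' then δ / 2 else 0) with hwdef
  have hwb : ∀ k, w k ≤ b k := by
    intro k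
    simp only [hwdef]
    have h0 := hb k
    by_cases h1 : k ∈ A <;> by_cases h2 : k ∈ A' <;> simp only [h1, h2, if_true, if_false]
    · have := hw k (by simp [A, A'] at h1 h2 ⊢; omega)
      linarith
    · have := hw k (by simp [A, A'] at h1 h2 ⊢; omega)
      linarith
    · have := hw k (by simp [A, A'] at h1 h2 ⊢; omega)
      linarith
    · linarith
  have hA : (#A : ℝ) = M := by simp [A]; omega
  have hA' : (#A' : ℝ) = M := by simp [A']; omega
  have hwsum : HasSum w (δ * M) := by
    have := (hasSum_ite_mem A fun _ => δ / 2).add (hasSum_ite_mem A' fun _ => δ / 2)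
    simp only [sum_const, nsmul_eq_mul, hA, hA'] at this
    convert! this using 1
    ring
  have hwe : HasSum (fun k => (w k : ℂ) * e k)
      (∑ k ∈ A, ((δ / 2 : ℝ) : ℂ) * (e k * (1 + Complex.exp (2 * y * Complex.I)))) := by
    have := (hasSum_ite_mem A fun k => ((δ / 2 : ℝ) : ℂ) * e k).add
      (hasSum_ite_mem A' fun k => ((δ / 2 : ℝ) : ℂ) * e k)
    rw [← sum_Ico_add' (fun k => ((δ / 2 : ℝ) : ℂ) * e k) M (2 * M) m, ← sum_add_distrib] at this
    convert! this using 1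
    · funext k
      simp only [hwdef]
      by_cases h1 : k ∈ A <;> by_cases h2 : k ∈ A' <;> simp only [h1, h2, if_true, if_false] <;>
        push_cast <;> ring
    · refine sum_congr rfl fun k _ => ?_
      rw [hem]; ring
  have hrest : Summable fun k => ((b k - w k : ℝ) : ℂ) * e k := by
    refine Summable.of_norm ?_
    refine (hs.sub hwsum.summable).congr fun k => ?_
    rw [norm_mul, he, mul_one, Complex.norm_real, Real.norm_of_nonneg (sub_nonneg.2 (hwb k))]
  have hsplit : ∑' k, (b k : ℂ) * e k =
      ∑' k, ((b k - w k : ℝ) : ℂ) * e k + ∑' k, (w k : ℂ) * e k := by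
    rw [← hrest.tsum_add hwe.summable]
    refine tsum_congr fun k => ?_
    push_cast; ring
  have h1 : ‖∑' k, ((b k - w k : ℝ) : ℂ) * e k‖ ≤ ∑' k, b k - δ * M := by
    refine tsum_of_norm_bounded (hs.hasSum.sub hwsum) fun k => ?_
    rw [norm_mul, he, mul_one, Complex.norm_real, Real.norm_of_nonneg (sub_nonneg.2 (hwb k))]
  have h2 : ‖∑' k, (w k : ℂ) * e k‖ ≤ δ * M * |Real.cos y| := by
    rw [hwe.tsum_eq]
    refine (norm_sum_le _ _).trans (le_of_eq ?_)
    have : ∀ k, ‖((δ / 2 : ℝ) : ℂ) * (e k * (1 + Complex.exp (2 * y * Complex.I)))‖ =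
        δ * |Real.cos y| := by
      intro k
      rw [norm_mul, norm_mul, he, norm_one_add_cexp, Complex.norm_real,
        Real.norm_of_nonneg (by positivity)]
      ring
    simp only [this, sum_const, nsmul_eq_mul, hA]
    ring
  rw [hsplit]
  refine (norm_add_le _ _).trans ?_
  linarith

/-- For `|θ| ≤ π` some shift `m ≤ M` makes `|m θ / 2| ≤ π / 2` comparable with
`min(π / 2, |M θ / 2|)`: take `m = M` if `M |θ| ≤ π`, and `m = ⌊π / |θ|⌋` otherwise. -/
theorem exists_shift {M : ℕ} {τ : ℝ} (hτ : 0 < τ) (hM : τ ≤ 2 * M) {θ : ℝ}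
    (hθ : |θ| ≤ Real.pi) :
    ∃ m : ℕ, m ≤ M ∧
      1 / (8 * Real.pi ^ 2) * min 1 ((θ * τ) ^ 2) ≤ 1 - |Real.cos (m * θ / 2)| := by
  have hpi := Real.pi_pos
  have key : ∀ y : ℝ, |y| ≤ Real.pi / 2 → 2 / Real.pi ^ 2 * y ^ 2 ≤ 1 - |Real.cos y| := by
    intro y hy
    have h0 := Real.cos_nonneg_of_mem_Icc (abs_le.1 hy)
    rw [abs_of_nonneg h0]
    linarith [Real.cos_le_one_sub_mul_cos_sq (x := y) (by linarith)]
  rcases le_or_gt (M * |θ|) Real.pi with h | h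
  · refine ⟨M, le_rfl, ?_⟩
    have hy : |M * θ / 2| ≤ Real.pi / 2 := by
      rw [abs_div, abs_mul, Nat.abs_cast, abs_of_pos (two_pos : (0 : ℝ) < 2)]; linarith
    refine le_trans ?_ (key _ hy)
    have h2 : min 1 ((θ * τ) ^ 2) ≤ (θ * (2 * M)) ^ 2 := by
      refine (min_le_right _ _).trans ?_
      rw [mul_pow, mul_pow]
      gcongr
    calc 1 / (8 * Real.pi ^ 2) * min 1 ((θ * τ) ^ 2)
        ≤ 1 / (8 * Real.pi ^ 2) * (θ * (2 * M)) ^ 2 := by gcongr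
      _ = 2 / Real.pi ^ 2 * (M * θ / 2) ^ 2 := by field_simp; ring
  · have hθ0 : 0 < |θ| := by
      rcases (abs_nonneg θ).eq_or_lt with h0 | h0
      · rw [← h0] at h; linarith
      · exact h0
    set m := ⌊Real.pi / |θ|⌋₊
    have hx1 : 1 ≤ Real.pi / |θ| := (one_le_div hθ0).2 hθ
    have hm1 : 1 ≤ m := Nat.one_le_floor_iff _ |>.2 hx1
    have hmle : (m : ℝ) ≤ Real.pi / |θ| := Nat.floor_le (by positivity)
    have hmlt : Real.pi / |θ| < m + 1 := Nat.lt_floor_add_one _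
    have hmlt' : Real.pi / |θ| ≤ 2 * m := by
      have : (1 : ℝ) ≤ m := by exact_mod_cast hm1
      linarith
    refine ⟨m, ?_, ?_⟩
    · have : (m : ℝ) < M := lt_of_le_of_lt hmle ((div_lt_iff₀ hθ0).2 h)
      exact_mod_cast this.le
    · have e1 : |m * θ / 2| = m * |θ| / 2 := by
        rw [abs_div, abs_mul, Nat.abs_cast, abs_of_pos (two_pos : (0 : ℝ) < 2)]
      have hy : |m * θ / 2| ≤ Real.pi / 2 := by
        rw [e1]; rw [le_div_iff₀ hθ0] at hmle; linarith
      refine le_trans ?_ (key _ hy)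
      have h3 : Real.pi / 4 ≤ |m * θ / 2| := by
        rw [e1]; rw [div_le_iff₀ hθ0] at hmlt'; linarith
      rw [← sq_abs (m * θ / 2)]
      calc 1 / (8 * Real.pi ^ 2) * min 1 ((θ * τ) ^ 2) ≤ 1 / (8 * Real.pi ^ 2) * 1 := by
            gcongr; exact min_le_left _ _
        _ ≤ 2 / Real.pi ^ 2 * (Real.pi / 4) ^ 2 := by
            rw [show 2 / Real.pi ^ 2 * (Real.pi / 4) ^ 2 = 1 / 8 by field_simp; norm_num, mul_one]
            have : 8 ≤ 8 * Real.pi ^ 2 := by nlinarith [Real.pi_gt_three]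
            exact one_div_le_one_div_of_le (by norm_num) this
        _ ≤ 2 / Real.pi ^ 2 * |m * θ / 2| ^ 2 := by gcongr

theorem min_rpow_le_rpow (r : ℝ) {x : ℝ} (h1 : 1 / 2 ≤ x) (h2 : x ≤ 3) :
    min ((1 / 2 : ℝ) ^ r) (3 ^ r) ≤ x ^ r := by
  rcases le_total 0 r with h | h
  · exact (min_le_left _ _).trans (Real.rpow_le_rpow (by norm_num) h1 h)
  · exact (min_le_right _ _).trans (Real.rpow_le_rpow_of_nonpos (by linarith) h2 h)

/-- The weights `a_k = k ^ (p - 1)`. -/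
noncomputable abbrev powWeight (p : ℝ) : ℕ → ℝ := fun k => (k : ℝ) ^ (p - 1)

theorem powWeight_pos (p : ℝ) : ∀ k, 1 ≤ k → 0 < powWeight p k := fun k hk =>
  Real.rpow_pos_of_pos (by exact_mod_cast hk) _

theorem summable_powWeight (p : ℝ) {σ : ℝ} (hσ : 0 < σ) :
    Summable fun k : ℕ => powWeight p (k + 1) * Real.exp (-σ * (k + 1)) := by
  simpa [powWeight] using summable_expSum p hσ

theorem tsum_powWeight (p σ : ℝ) :
    ∑' k : ℕ, powWeight p (k + 1) * Real.exp (-σ * (k + 1)) = expSum p σ := by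
  simp [powWeight, expSum]

/-- Off the real axis the generating function is smaller than on it, by the amount
`σ ^ (-p) min(1, (θ / σ) ^ 2)` up to a constant. -/
theorem exists_norm_genFun_le (p : ℝ) : ∃ c : ℝ, 0 < c ∧ ∀ σ θ : ℝ, 0 < σ → σ ≤ 1 →
    |θ| ≤ Real.pi → ‖genFun (powWeight p) (σ - θ * Complex.I)‖ ≤
      expSum p σ - c * σ ^ (-p) * min 1 ((θ / σ) ^ 2) := by
  set c₁ := min ((1 / 2 : ℝ) ^ (p - 1)) (3 ^ (p - 1))
  have hc₁ : 0 < c₁ := lt_min (by positivity) (by positivity)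
  have hpi := Real.pi_pos
  refine ⟨c₁ * Real.exp (-3) / 2 * (1 / (8 * Real.pi ^ 2)), by positivity, ?_⟩
  intro σ θ hσ hσ1 hθ
  -- for `M ≤ k < 3 M` the product `σ (k + 1)` lies in `[1 / 2, 3]`, where the summand is at least
  -- a constant times `σ ^ (1 - p)`
  set M := ⌊1 / σ⌋₊
  have hx1 : 1 ≤ 1 / σ := (one_le_div hσ).2 hσ1
  have hM1 : (1 : ℝ) ≤ M := by exact_mod_cast (Nat.one_le_floor_iff _).2 hx1
  have hMle : (M : ℝ) ≤ 1 / σ := Nat.floor_le (by positivity)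
  have hMge : 1 / σ ≤ 2 * M := by linarith [Nat.lt_floor_add_one (1 / σ)]
  obtain ⟨m, hm, hgap⟩ := exists_shift (M := M) (τ := 1 / σ) (by positivity) hMge hθ
  set δ := c₁ * σ ^ (1 - p) * Real.exp (-3)
  have hδ : 0 ≤ δ := by positivity
  have hw : ∀ k ∈ Ico M (3 * M), δ ≤ powWeight p (k + 1) * Real.exp (-σ * (k + 1)) := by
    intro k hk
    rw [mem_Ico] at hk
    have hk1 : (M : ℝ) ≤ k := by exact_mod_cast hk.1
    have hk2 : (k : ℝ) + 1 ≤ 3 * M := by exact_mod_cast hk.2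
    rw [le_div_iff₀ hσ] at hMle
    rw [div_le_iff₀ hσ] at hMge
    have h1 : 1 / 2 ≤ σ * (k + 1) := by nlinarith
    have h2 : σ * (k + 1) ≤ 3 := by nlinarith
    have h3 := min_rpow_le_rpow (p - 1) h1 h2
    have h4 : powWeight p (k + 1) = (σ * (k + 1)) ^ (p - 1) * σ ^ (1 - p) := by
      rw [Real.mul_rpow hσ.le (by positivity), mul_right_comm, ← Real.rpow_add hσ]
      simp [powWeight]
    rw [h4]
    have h5 : Real.exp (-3) ≤ Real.exp (-σ * (k + 1)) := Real.exp_le_exp.2 (by linarith)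
    exact mul_le_mul (mul_le_mul_of_nonneg_right h3 (by positivity)) h5 (by positivity)
      (by positivity)
  have hmain := norm_tsum_le_sub (b := fun k : ℕ => powWeight p (k + 1) * Real.exp (-σ * (k + 1)))
    (fun k => mul_nonneg (powWeight_pos p _ (by simp)).le (Real.exp_nonneg _))
    (summable_powWeight p hσ) hδ hm hw (e := fun k => Complex.exp (θ * (k + 1) * Complex.I))
    (y := m * θ / 2) (fun k => by
      have : ((θ : ℂ) * (k + 1) * Complex.I) = ((θ * (k + 1) : ℝ) : ℂ) * Complex.I := by
        push_cast; ring
      rw [this, Complex.norm_exp_ofReal_mul_I])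
    (fun k => by rw [← Complex.exp_add]; congr 1; push_cast; ring)
  rw [tsum_powWeight] at hmain
  have hgen : genFun (powWeight p) (σ - θ * Complex.I) =
      ∑' k : ℕ, ((powWeight p (k + 1) * Real.exp (-σ * (k + 1)) : ℝ) : ℂ) *
        Complex.exp (θ * (k + 1) * Complex.I) := by
    refine tsum_congr fun k => ?_
    rw [Complex.ofReal_mul, Complex.ofReal_exp, mul_assoc, ← Complex.exp_add]
    congr 2; push_cast; ring
  rw [hgen]
  refine hmain.trans (sub_le_sub_left ?_ _)
  have hδM : c₁ * Real.exp (-3) / 2 * σ ^ (-p) ≤ δ * M := by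
    have : σ ^ (1 - p) = σ * σ ^ (-p) := by
      rw [sub_eq_add_neg, Real.rpow_add hσ, Real.rpow_one]
    simp only [δ]
    rw [this]
    rw [div_le_iff₀ hσ] at hMge
    have h0 : 0 ≤ c₁ * Real.exp (-3) * σ ^ (-p) := by positivity
    nlinarith
  have hmin : 0 ≤ 1 / (8 * Real.pi ^ 2) * min 1 ((θ * (1 / σ)) ^ 2) := by positivity
  calc _ = c₁ * Real.exp (-3) / 2 * σ ^ (-p) *
        (1 / (8 * Real.pi ^ 2) * min 1 ((θ * (1 / σ)) ^ 2)) := by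
        rw [mul_one_div θ σ]; ring
    _ ≤ δ * M * (1 - |Real.cos (m * θ / 2)|) := by
        exact mul_le_mul hδM hgap hmin (by positivity)

end CoagFrag

/-! ### Expansion near the real axis -/

namespace CoagFrag

open Filter Topology MeasureTheory Finset

theorem norm_cexp_mul_I_sub_le (y : ℝ) :
    ‖Complex.exp (y * Complex.I) - (1 + y * Complex.I - (y : ℂ) ^ 2 / 2)‖ ≤ 4 * |y| ^ 3 := by
  have hn : ‖(y : ℂ) * Complex.I‖ = |y| := by simp
  rcases le_or_gt |y| 1 with h | h
  · have h1 := Complex.exp_bound (x := y * Complex.I) (by rwa [hn]) (n := 3) (by norm_num)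
    rw [hn] at h1
    have h2 : ∑ m ∈ range 3, ((y : ℂ) * Complex.I) ^ m / (m ! : ℂ) =
        1 + y * Complex.I - (y : ℂ) ^ 2 / 2 := by
      simp [sum_range_succ, mul_pow, Nat.factorial]; ring
    rw [h2] at h1
    refine h1.trans ?_
    have : ((Nat.succ 3 : ℕ) : ℝ) * (((3 ! : ℕ) : ℝ) * (3 : ℕ))⁻¹ ≤ 4 := by
      norm_num [Nat.factorial]
    nlinarith [pow_nonneg (abs_nonneg y) 3]
  · have h1 : ‖Complex.exp (y * Complex.I)‖ = 1 := Complex.norm_exp_ofReal_mul_I y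
    have h2 : ‖(1 : ℂ) + y * Complex.I - (y : ℂ) ^ 2 / 2‖ ≤ 1 + |y| + |y| ^ 2 / 2 := by
      refine (norm_sub_le _ _).trans (add_le_add ((norm_add_le _ _).trans ?_) ?_)
      · rw [hn, norm_one]
      · simp
    refine (norm_sub_le _ _).trans ?_
    rw [h1]
    have h3 : |y| ≤ |y| ^ 3 := le_self_pow₀ h.le (by norm_num)
    have h4 : |y| ^ 2 ≤ |y| ^ 3 := pow_le_pow_right₀ h.le (by norm_num)
    linarith

/-- Second order expansion of the generating function along the imaginary direction. -/
theorem norm_genFun_sub_taylor_le (p : ℝ) {σ : ℝ} (hσ : 0 < σ) (θ : ℝ) :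
    ‖genFun (powWeight p) (σ - θ * Complex.I) - (expSum p σ + θ * Complex.I * expSum (p + 1) σ
        - (θ : ℂ) ^ 2 / 2 * expSum (p + 2) σ)‖ ≤ 4 * |θ| ^ 3 * expSum (p + 3) σ := by
  have hterm : ∀ j : ℕ, ∀ k : ℕ, ((k : ℝ) + 1) ^ (p + j - 1) * Real.exp (-σ * (k + 1)) =
      powWeight p (k + 1) * Real.exp (-σ * (k + 1)) * ((k : ℝ) + 1) ^ j := by
    intro j k
    have : (0 : ℝ) < (k : ℝ) + 1 := by positivity
    rw [show p + j - 1 = (p - 1) + (j : ℕ) by ring, Real.rpow_add this, Real.rpow_natCast]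
    simp only [powWeight, Nat.cast_add, Nat.cast_one]; ring
  set b : ℕ → ℝ := fun k => powWeight p (k + 1) * Real.exp (-σ * (k + 1)) with hb
  have hb0 : ∀ k, 0 ≤ b k := fun k =>
    mul_nonneg (powWeight_pos p _ (by simp)).le (Real.exp_nonneg _)
  have hS : ∀ j : ℕ, HasSum (fun k : ℕ => b k * ((k : ℝ) + 1) ^ j) (expSum (p + j) σ) := by
    intro j
    have := (summable_expSum (p + j) hσ).hasSum
    simp only [hterm j] at this
    convert! this using 1
    simp only [expSum, hterm j]
  have hC : ∀ j : ℕ,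
      HasSum (fun k : ℕ => (b k : ℂ) * ((k : ℂ) + 1) ^ j) (expSum (p + j) σ : ℂ) := by
    intro j
    have := Complex.hasSum_ofReal.2 (hS j)
    push_cast at this
    exact this
  have h0 := hC 0
  have h1 := (hC 1).mul_left (θ * Complex.I)
  have h2 := (hC 2).mul_left ((θ : ℂ) ^ 2 / 2)
  have h3 := (hS 3).mul_left (4 * |θ| ^ 3)
  simp only [Nat.cast_zero, add_zero, Nat.cast_one, Nat.cast_ofNat] at h0 h1 h2 h3
  have hgen : HasSum (fun k : ℕ => (b k : ℂ) * Complex.exp ((θ * (k + 1) : ℝ) * Complex.I))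
      (genFun (powWeight p) (σ - θ * Complex.I)) := by
    have hs : Summable fun k : ℕ => (b k : ℂ) * Complex.exp ((θ * (k + 1) : ℝ) * Complex.I) := by
      refine Summable.of_norm ((summable_powWeight p hσ).congr fun k => ?_)
      rw [norm_mul, Complex.norm_exp_ofReal_mul_I, mul_one, Complex.norm_real,
        Real.norm_of_nonneg (hb0 k)]
    convert! hs.hasSum using 1
    refine tsum_congr fun k => ?_
    rw [hb]
    simp only
    rw [Complex.ofReal_mul, Complex.ofReal_exp, mul_assoc, ← Complex.exp_add]
    congr 2; push_cast; ring
  have hdiff := hgen.sub ((h0.add h1).sub h2)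
  rw [← hdiff.tsum_eq]
  refine tsum_of_norm_bounded h3 fun k => ?_
  have hfac : (b k : ℂ) * Complex.exp ((θ * (k + 1) : ℝ) * Complex.I) -
      ((b k : ℂ) * ((k : ℂ) + 1) ^ 0 + θ * Complex.I * ((b k : ℂ) * ((k : ℂ) + 1) ^ 1) -
        (θ : ℂ) ^ 2 / 2 * ((b k : ℂ) * ((k : ℂ) + 1) ^ 2)) =
      (b k : ℂ) * (Complex.exp ((θ * (k + 1) : ℝ) * Complex.I) -
        (1 + (θ * (k + 1) : ℝ) * Complex.I - ((θ * (k + 1) : ℝ) : ℂ) ^ 2 / 2)) := by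
    push_cast; ring
  rw [hfac, norm_mul, Complex.norm_real, Real.norm_of_nonneg (hb0 k)]
  have hk : (0 : ℝ) < (k : ℝ) + 1 := by positivity
  calc b k * _ ≤ b k * (4 * |θ * (k + 1)| ^ 3) :=
        mul_le_mul_of_nonneg_left (norm_cexp_mul_I_sub_le _) (hb0 k)
    _ = 4 * |θ| ^ 3 * (b k * ((k : ℝ) + 1) ^ 3) := by
        rw [abs_mul, abs_of_pos hk]; ring

section Limits

variable {ι : Type*} {l : Filter ι} {σ : ι → ℝ}

theorem tendsto_rpow_zero (hσ : Tendsto σ l (𝓝[>] 0)) {q : ℝ} (hq : 0 < q) :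
    Tendsto (fun i => σ i ^ q) l (𝓝 0) := by
  have h := (Real.continuousAt_rpow_const 0 q (Or.inr hq.le)).tendsto.comp
    (tendsto_nhdsWithin_iff.1 hσ).1
  rwa [Real.zero_rpow hq.ne'] at h

theorem eventually_pos (hσ : Tendsto σ l (𝓝[>] 0)) : ∀ᶠ i in l, 0 < σ i :=
  (tendsto_nhdsWithin_iff.1 hσ).2

/-- The error in the approximation of `expSum` is negligible against any positive power. -/
theorem tendsto_rpow_mul_expSum_sub (hσ : Tendsto σ l (𝓝[>] 0)) {q r : ℝ} (hq : 0 < q)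
    (hr : 0 < r) :
    Tendsto (fun i => σ i ^ r * (expSum q (σ i) - Real.Gamma q * σ i ^ (-q))) l (𝓝 0) := by
  obtain ⟨C, hC⟩ := exists_abs_expSum_sub_le hq
  refine squeeze_zero_norm' (a := fun i => σ i ^ r * C) ?_ ?_
  · filter_upwards [eventually_pos hσ] with i hi
    rw [norm_mul, Real.norm_eq_abs, Real.norm_eq_abs, abs_of_pos (by positivity)]
    exact mul_le_mul_of_nonneg_left (hC _ hi) (by positivity)
  · simpa using (tendsto_rpow_zero hσ hr).mul_const C

theorem tendsto_rpow_mul_expSum (hσ : Tendsto σ l (𝓝[>] 0)) {q : ℝ} (hq : 0 < q) :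
    Tendsto (fun i => σ i ^ q * expSum q (σ i)) l (𝓝 (Real.Gamma q)) := by
  have h := (tendsto_rpow_mul_expSum_sub hσ hq hq).add_const (Real.Gamma q)
  rw [zero_add] at h
  refine h.congr' ?_
  filter_upwards [eventually_pos hσ] with i hi
  have : σ i ^ q * σ i ^ (-q) = 1 := by rw [← Real.rpow_add hi]; simp
  linear_combination (-Real.Gamma q) * this

variable {p : ℝ}

/-- On the scale `θ = σ ^ (1 + p / 2) u` the generating function is quadratic in the limit, after
removal of its constant and linear terms. -/
theorem tendsto_genFun_sub (hp : 0 < p) (hσ : Tendsto σ l (𝓝[>] 0)) (u : ℝ) :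
    Tendsto (fun i => genFun (powWeight p) (σ i - (σ i ^ (1 + p / 2) * u : ℝ) * Complex.I)
      - expSum p (σ i) - (σ i ^ (1 + p / 2) * u : ℝ) * Complex.I * expSum (p + 1) (σ i)) l
      (𝓝 (-(Real.Gamma (p + 2) * u ^ 2 / 2 : ℝ))) := by
  have h2 : Tendsto (fun i => ((σ i ^ (1 + p / 2) * u) ^ 2 / 2 * expSum (p + 2) (σ i) : ℝ)) l
      (𝓝 (Real.Gamma (p + 2) * u ^ 2 / 2)) := by
    refine ((tendsto_rpow_mul_expSum hσ (q := p + 2) (by linarith)).mul_const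
      (u ^ 2 / 2)).congr' ?_ |>.trans (by rw [mul_div_assoc])
    filter_upwards [eventually_pos hσ] with i hi
    have : (σ i ^ (1 + p / 2)) ^ 2 = σ i ^ (p + 2) := by
      rw [← Real.rpow_natCast, ← Real.rpow_mul hi.le]; congr 1; push_cast; ring
    rw [mul_pow, this]; ring
  have h3 : Tendsto (fun i => 4 * |σ i ^ (1 + p / 2) * u| ^ 3 * expSum (p + 3) (σ i)) l
      (𝓝 0) := by
    have := ((tendsto_rpow_mul_expSum hσ (q := p + 3) (by linarith)).mul
      (tendsto_rpow_zero hσ (q := p / 2) (by linarith))).mul_const (4 * |u| ^ 3)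
    rw [mul_zero, zero_mul] at this
    refine this.congr' ?_
    filter_upwards [eventually_pos hσ] with i hi
    have h : (σ i ^ (1 + p / 2)) ^ 3 = σ i ^ (p + 3) * σ i ^ (p / 2) := by
      rw [← Real.rpow_natCast, ← Real.rpow_mul hi.le, ← Real.rpow_add hi]
      congr 1; push_cast; ring
    rw [abs_mul, mul_pow, abs_of_pos (Real.rpow_pos_of_pos hi _), h]; ring
  have hR : Tendsto (fun i => genFun (powWeight p)
      (σ i - (σ i ^ (1 + p / 2) * u : ℝ) * Complex.I) -
      (expSum p (σ i) + (σ i ^ (1 + p / 2) * u : ℝ) * Complex.I * expSum (p + 1) (σ i)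
        - ((σ i ^ (1 + p / 2) * u : ℝ) : ℂ) ^ 2 / 2 * expSum (p + 2) (σ i))) l (𝓝 0) := by
    refine squeeze_zero_norm' ?_ h3
    filter_upwards [eventually_pos hσ] with i hi
    exact norm_genFun_sub_taylor_le p hi _
  have h := hR.sub ((Complex.continuous_ofReal.tendsto _).comp h2)
  rw [zero_sub] at h
  refine h.congr fun i => ?_
  simp only [Function.comp_apply]
  push_cast; ring

variable {N : ι → ℕ}

/-- The exponent of the normalized integrand of `c_N` converges: `S'(σ) + N` is bounded, so the
linear term disappears in the limit. -/
theorem tendsto_log_partition_integrand (hp : 0 < p) (hσ : Tendsto σ l (𝓝[>] 0))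
    (hN : ∀ᶠ i in l, (N i : ℝ) = Real.Gamma (p + 1) * σ i ^ (-(p + 1))) (u : ℝ) :
    Tendsto (fun i => genFun (powWeight p) (σ i - (σ i ^ (1 + p / 2) * u : ℝ) * Complex.I)
      - expSum p (σ i) - N i * Complex.I * (σ i ^ (1 + p / 2) * u : ℝ)) l
      (𝓝 (-(Real.Gamma (p + 2) * u ^ 2 / 2 : ℝ))) := by
  have h1 := (tendsto_rpow_mul_expSum_sub hσ (q := p + 1) (r := 1 + p / 2) (by linarith)
    (by linarith)).mul_const u
  rw [zero_mul] at h1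
  have h2 := ((Complex.continuous_ofReal.tendsto _).comp h1).mul_const Complex.I
  have h := (tendsto_genFun_sub hp hσ u).add h2
  rw [Complex.ofReal_zero, zero_mul, add_zero] at h
  refine h.congr' ?_
  filter_upwards [hN] with i hi
  have hi' : (N i : ℂ) = ((Real.Gamma (p + 1) * σ i ^ (-(p + 1)) : ℝ) : ℂ) := by
    rw [← hi]; simp
  rw [hi']
  simp only [Function.comp_apply]
  push_cast; ring

/-- If `D ^ 2 / n` converges and `n → ∞` then `(1 + D / n) ^ n e ^ (-D)` converges. -/
theorem tendsto_one_add_div_pow_mul_cexp {n : ι → ℕ} (hn : Tendsto n l atTop) {D : ι → ℂ} {V : ℂ}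
    (hD : Tendsto (fun i => D i ^ 2 / n i) l (𝓝 V)) :
    Tendsto (fun i => (1 + D i / n i) ^ n i * Complex.exp (-D i)) l
      (𝓝 (Complex.exp (-(V / 2)))) := by
  have hn0 : ∀ᶠ i in l, 0 < n i := hn.eventually_gt_atTop 0
  have hinv : Tendsto (fun i => ((n i : ℝ))⁻¹) l (𝓝 0) :=
    tendsto_inv_atTop_zero.comp (tendsto_natCast_atTop_atTop.comp hn)
  have hz : Tendsto (fun i => ‖D i / n i‖) l (𝓝 0) := by
    have h := (hD.norm.mul hinv).sqrt
    rw [mul_zero, Real.sqrt_zero] at h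
    refine h.congr fun i => ?_
    rw [Real.sqrt_eq_iff_mul_self_eq (by positivity) (by positivity)]
    simp only [norm_div, norm_pow, Complex.norm_natCast]
    ring
  have hsmall : ∀ᶠ i in l, ‖D i / n i‖ < 1 / 2 := hz.eventually_lt_const (by norm_num)
  have herr : Tendsto (fun i => (n i : ℂ) * (Complex.log (1 + D i / n i) -
      Complex.logTaylor 3 (D i / n i))) l (𝓝 0) := by
    have h := hD.norm.mul hz
    rw [mul_zero] at h
    refine squeeze_zero_norm' ?_ h
    filter_upwards [hsmall, hn0] with i hi hi0
    have h1 := Complex.norm_log_sub_logTaylor_le 2 (z := D i / n i) (by linarith)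
    rw [norm_mul, Complex.norm_natCast]
    have h2 : (1 - ‖D i / n i‖)⁻¹ ≤ 2 := by
      rw [inv_le_comm₀ (by linarith) (by norm_num)]; linarith
    have hni : (0 : ℝ) < n i := by exact_mod_cast hi0
    have h3 : ‖D i ^ 2 / n i‖ * ‖D i / n i‖ = n i * ‖D i / n i‖ ^ 3 := by
      simp only [norm_div, norm_pow, Complex.norm_natCast]
      field_simp
    rw [h3]
    refine mul_le_mul_of_nonneg_left (h1.trans ?_) hni.le
    have h4 : 0 ≤ ‖D i / n i‖ ^ 3 := by positivity
    norm_num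
    simp only [norm_div, Complex.norm_natCast] at h2 h4 ⊢
    nlinarith
  have hlim := herr.sub (hD.div_const 2)
  rw [zero_sub] at hlim
  refine ((Complex.continuous_exp.tendsto _).comp hlim).congr' ?_
  filter_upwards [hsmall, hn0] with i hi hi0
  have hne : (1 : ℂ) + D i / n i ≠ 0 := by
    intro h
    have : D i / n i = -1 := by linear_combination h
    rw [this] at hi
    norm_num at hi
  have hni : (n i : ℂ) ≠ 0 := by exact_mod_cast hi0.ne'
  have htay : Complex.logTaylor 3 (D i / n i) = D i / n i - (D i / n i) ^ 2 / 2 := by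
    simp [Complex.logTaylor, sum_range_succ]; ring
  conv_rhs => rw [← Complex.exp_log hne, ← Complex.exp_nat_mul, ← Complex.exp_add]
  simp only [Function.comp_apply]
  congr 1
  rw [htay]
  field_simp
  ring

end Limits

end CoagFrag

/-! ### Laplace's method -/

namespace CoagFrag

open Filter Topology MeasureTheory Finset

theorem integrable_exp_neg_mul_abs_rpow {b γ : ℝ} (hb : 0 < b) (hγ : 0 < γ) :
    Integrable fun u : ℝ => Real.exp (-b * |u| ^ γ) := by
  have h0 : IntegrableOn (fun x : ℝ => Real.exp (-b * x ^ γ)) (Set.Ioi 0) := by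
    simpa using integrableOn_rpow_mul_exp_neg_mul_rpow (s := 0) (by norm_num) hγ hb
  have h1 : IntegrableOn (fun u : ℝ => Real.exp (-b * |u| ^ γ)) (Set.Ioi 0) :=
    h0.congr_fun (fun x hx => by simp only [abs_of_pos (Set.mem_Ioi.1 hx)]) measurableSet_Ioi
  have h2 : IntegrableOn (fun u : ℝ => Real.exp (-b * |u| ^ γ)) (Set.Iic 0) := by
    rw [integrableOn_Iic_iff_integrableOn_Iio]
    have := h1.comp_neg
    simpa using this
  have := h2.union h1
  rwa [Set.Iic_union_Ioi, integrableOn_univ] at this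

/-- For `θ = σ ^ (1 + p / 2) u` with `|θ| ≤ π`, the exponent `min(σ ^ (-p), u ^ 2)` is bounded below
by a power of `|u|` that does not depend on `σ`; this makes the dominating function integrable. -/
theorem rpow_sub_one_le_min {p σ u : ℝ} (hp : 0 < p) (hσ : 0 < σ)
    (hu : |u| * σ ^ (1 + p / 2) ≤ Real.pi) :
    (|u| / Real.pi) ^ (p / (1 + p / 2)) - 1 ≤ min (σ ^ (-p)) (u ^ 2) := by
  have hpi := Real.pi_pos
  have hγ0 : 0 < p / (1 + p / 2) := by positivity
  refine le_min ?_ ?_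
  · have h1 : |u| / Real.pi ≤ σ ^ (-(1 + p / 2)) := by
      rw [div_le_iff₀ hpi, Real.rpow_neg hσ.le, inv_mul_eq_div, le_div_iff₀ (by positivity)]
      exact hu
    have h2 := Real.rpow_le_rpow (by positivity) h1 hγ0.le
    rw [← Real.rpow_mul hσ.le, neg_mul, mul_div_cancel₀ _ (by positivity)] at h2
    linarith
  · rcases le_or_gt (|u| / Real.pi) 1 with h | h
    · have := Real.rpow_le_one (by positivity) h hγ0.le
      nlinarith [sq_nonneg u]
    · have hγ2 : p / (1 + p / 2) ≤ (2 : ℕ) := by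
        rw [div_le_iff₀ (by positivity)]; push_cast; linarith
      have h1 := Real.rpow_le_rpow_of_exponent_le h.le hγ2
      rw [Real.rpow_natCast] at h1
      have h2 : |u| / Real.pi ≤ |u| := div_le_self (abs_nonneg u) (by linarith [Real.pi_gt_three])
      have h3 := pow_le_pow_left₀ (by positivity) h2 2
      rw [sq_abs] at h3
      linarith

/-- Laplace's method for integrands dominated by `e ^ (|S| - S(σ))`, where `S` is the generating
function: only the scale `θ = σ ^ (1 + p / 2) u` contributes. -/
theorem tendsto_integral_of_norm_le {ι : Type*} {l : Filter ι} [l.IsCountablyGenerated]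
    {σ : ι → ℝ} {p : ℝ} (hp : 0 < p) (hσ : Tendsto σ l (𝓝[>] 0)) {H : ι → ℝ → ℂ} {h : ℝ → ℂ}
    (hcont : ∀ᶠ i in l, Continuous (H i))
    (hbound : ∀ᶠ i in l, ∀ θ : ℝ, ‖H i θ‖ ≤
      Real.exp (‖genFun (powWeight p) (σ i - θ * Complex.I)‖ - expSum p (σ i)))
    (hlim : ∀ u : ℝ, Tendsto (fun i => H i (σ i ^ (1 + p / 2) * u)) l (𝓝 (h u))) :
    Tendsto (fun i => ((σ i ^ (1 + p / 2) : ℝ) : ℂ)⁻¹ * ∫ θ in (-Real.pi)..Real.pi, H i θ) l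
      (𝓝 (∫ u, h u)) := by
  obtain ⟨c, hc, hS⟩ := exists_norm_genFun_le p
  have hpi := Real.pi_pos
  set γ := p / (1 + p / 2) with hγdef
  have hγ0 : 0 < γ := by positivity
  set ρ : ι → ℝ := fun i => σ i ^ (1 + p / 2) with hρ
  have hρ0 : Tendsto ρ l (𝓝 0) := tendsto_rpow_zero hσ (by positivity)
  have hσ1 : ∀ᶠ i in l, σ i ≤ 1 := by
    filter_upwards [(tendsto_nhdsWithin_iff.1 hσ).1.eventually_lt_const one_pos] with i hi
      using hi.le
  have hpos := eventually_pos hσ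
  have hD := tendsto_integral_filter_of_dominated_convergence (μ := volume) (l := l)
    (F := fun i u => (Set.Ioc (-Real.pi / ρ i) (Real.pi / ρ i)).indicator
      (fun u => H i (ρ i * u)) u) (f := h)
    (fun u => Real.exp c * Real.exp (-(c / Real.pi ^ γ) * |u| ^ γ)) ?_ ?_ ?_ ?_
  · refine hD.congr' ?_
    filter_upwards [hpos] with i hi
    have hρi : 0 < ρ i := Real.rpow_pos_of_pos hi _
    rw [integral_indicator measurableSet_Ioc, ← intervalIntegral.integral_of_le
      (div_le_div_of_nonneg_right (by linarith) hρi.le),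
      intervalIntegral.integral_comp_mul_left _ hρi.ne', mul_div_cancel₀ _ hρi.ne',
      mul_div_cancel₀ _ hρi.ne', Complex.real_smul, Complex.ofReal_inv]
  · filter_upwards [hcont] with i hi
    exact ((hi.comp (continuous_const.mul continuous_id)).aestronglyMeasurable).indicator
      measurableSet_Ioc
  · filter_upwards [hpos, hσ1, hbound] with i hi hi1 hb
    refine Eventually.of_forall fun u => ?_
    have hρi : 0 < ρ i := Real.rpow_pos_of_pos hi _
    by_cases hu : u ∈ Set.Ioc (-Real.pi / ρ i) (Real.pi / ρ i)
    · rw [Set.indicator_of_mem hu]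
      have hu' : |u| * ρ i ≤ Real.pi := by
        rw [← le_div_iff₀ hρi, abs_le, ← neg_div]
        exact ⟨hu.1.le, hu.2⟩
      have hθ : |ρ i * u| ≤ Real.pi := by
        rw [abs_mul, abs_of_pos hρi, mul_comm]; exact hu'
      refine (hb _).trans ?_
      rw [← Real.exp_add, Real.exp_le_exp]
      have h1 := hS (σ i) (ρ i * u) hi hi1 hθ
      have h2 := rpow_sub_one_le_min hp hi hu'
      have h3 : σ i ^ (-p) * min 1 ((ρ i * u / σ i) ^ 2) = min (σ i ^ (-p)) (u ^ 2) := by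
        rw [mul_min_of_nonneg _ _ (by positivity), mul_one]
        congr 1
        have e1 : ρ i / σ i = σ i ^ (p / 2) := by
          rw [hρ]; simp only; rw [← Real.rpow_sub_one hi.ne']; congr 1; ring
        rw [mul_div_right_comm, e1, mul_pow, ← Real.rpow_natCast (σ i ^ (p / 2)),
          ← Real.rpow_mul hi.le, ← mul_assoc, ← Real.rpow_add hi]
        norm_num
      have h4 : c / Real.pi ^ γ * |u| ^ γ = c * (|u| / Real.pi) ^ γ := by
        rw [Real.div_rpow (abs_nonneg u) hpi.le]; ring
      rw [mul_assoc, h3] at h1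
      rw [← hγdef] at h2
      have h5 := mul_le_mul_of_nonneg_left h2 hc.le
      rw [neg_mul, h4]
      linarith
    · rw [Set.indicator_of_notMem hu, norm_zero]
      positivity
  · exact (integrable_exp_neg_mul_abs_rpow (by positivity) hγ0).const_mul _
  · refine Eventually.of_forall fun u => (hlim u).congr' ?_
    have h1 : Tendsto (fun i => |u| * ρ i) l (𝓝 0) := by simpa using hρ0.const_mul |u|
    filter_upwards [hpos, h1.eventually_lt_const hpi] with i hi hu
    have hρi : 0 < ρ i := Real.rpow_pos_of_pos hi _
    rw [← lt_div_iff₀ hρi, abs_lt, ← neg_div] at hu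
    rw [Set.indicator_of_mem (Set.mem_Ioc.2 ⟨hu.1, hu.2.le⟩)]

end CoagFrag

/-! ### The local limit theorem -/

namespace CoagFrag

open Filter Topology MeasureTheory Finset

section LocalLimit

variable {ι : Type*} {l : Filter ι} {σ : ι → ℝ} {p : ℝ} {N n : ι → ℕ} {s : ℝ}

theorem tendsto_rpow_mul_count (hp : 0 < p) (hσ : Tendsto σ l (𝓝[>] 0))
    (hs : Tendsto (fun i => σ i ^ (p / 2) * (n i - Real.Gamma p * σ i ^ (-p))) l (𝓝 s)) :
    Tendsto (fun i => σ i ^ p * n i) l (𝓝 (Real.Gamma p)) := by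
  have h := ((tendsto_rpow_zero hσ (q := p / 2) (by linarith)).mul hs).add_const (Real.Gamma p)
  rw [zero_mul, zero_add] at h
  refine h.congr' ?_
  filter_upwards [eventually_pos hσ] with i hi
  have h1 : σ i ^ (p / 2) * σ i ^ (p / 2) = σ i ^ p := by
    rw [← Real.rpow_add hi]; congr 1; ring
  have h2 : σ i ^ p * σ i ^ (-p) = 1 := by rw [← Real.rpow_add hi]; simp
  rw [← mul_assoc, h1]
  linear_combination (-Real.Gamma p) * h2

theorem tendsto_count_atTop (hp : 0 < p) (hσ : Tendsto σ l (𝓝[>] 0))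
    (hs : Tendsto (fun i => σ i ^ (p / 2) * (n i - Real.Gamma p * σ i ^ (-p))) l (𝓝 s)) :
    Tendsto n l atTop := by
  have h1 := tendsto_rpow_mul_count hp hσ hs
  have h2 : Tendsto (fun i => (σ i ^ p)⁻¹) l atTop := by
    refine tendsto_inv_nhdsGT_zero.comp (tendsto_nhdsWithin_iff.2 ⟨tendsto_rpow_zero hσ hp, ?_⟩)
    filter_upwards [eventually_pos hσ] with i hi using Real.rpow_pos_of_pos hi _
  have h3 := h2.atTop_mul_pos (Real.Gamma_pos_of_pos hp) h1
  rw [← tendsto_natCast_atTop_iff (R := ℝ)]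
  refine h3.congr' ?_
  filter_upwards [eventually_pos hσ] with i hi
  rw [inv_mul_cancel_left₀ (Real.rpow_pos_of_pos hi _).ne']

/-- The limit of the normalized integrand for the partitions with `n` parts. It is written as
`(1 + D / n) ^ n e ^ (-D)` with `D = S - n`, times the normalized integrand of `c_N`. -/
theorem tendsto_count_integrand (hp : 0 < p) (hσ : Tendsto σ l (𝓝[>] 0))
    (hN : ∀ᶠ i in l, (N i : ℝ) = Real.Gamma (p + 1) * σ i ^ (-(p + 1)))
    (hs : Tendsto (fun i => σ i ^ (p / 2) * (n i - Real.Gamma p * σ i ^ (-p))) l (𝓝 s)) (u : ℝ) :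
    Tendsto (fun i =>
      (genFun (powWeight p) (σ i - (σ i ^ (1 + p / 2) * u : ℝ) * Complex.I) / n i) ^ n i *
        Complex.exp (n i - expSum p (σ i) - N i * Complex.I * (σ i ^ (1 + p / 2) * u : ℝ))) l
      (𝓝 (Complex.exp (-((u * Real.Gamma (p + 1) * Complex.I - s) ^ 2 / Real.Gamma p / 2)) *
        Complex.exp (-(Real.Gamma (p + 2) * u ^ 2 / 2 : ℝ)))) := by
  have hG := Real.Gamma_pos_of_pos hp
  have hn := tendsto_count_atTop hp hσ hs
  set S : ι → ℂ := fun i => genFun (powWeight p) (σ i - (σ i ^ (1 + p / 2) * u : ℝ) * Complex.I)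
  set D : ι → ℂ := fun i => S i - n i with hDdef
  have hofR : ∀ {f : ι → ℝ} {x : ℝ}, Tendsto f l (𝓝 x) →
      Tendsto (fun i => (f i : ℂ)) l (𝓝 (x : ℂ)) := fun h =>
    (Complex.continuous_ofReal.tendsto _).comp h
  have hD : Tendsto (fun i => ((σ i ^ (p / 2) : ℝ) : ℂ) * D i) l
      (𝓝 (u * Real.Gamma (p + 1) * Complex.I - s)) := by
    have h1 := (hofR (tendsto_rpow_zero hσ (q := p / 2) (by linarith))).mul
      (tendsto_genFun_sub hp hσ u)
    have h2 := (hofR (tendsto_rpow_mul_expSum hσ (q := p + 1) (by linarith))).const_mul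
      (u * Complex.I)
    have h3 := hofR (tendsto_rpow_mul_expSum_sub hσ hp (r := p / 2) (by linarith))
    have h := ((h1.add h2).add h3).sub (hofR hs)
    rw [Complex.ofReal_zero, zero_mul, zero_add, add_zero] at h
    rw [show (u : ℂ) * Real.Gamma (p + 1) * Complex.I - s =
      u * Complex.I * Real.Gamma (p + 1) - s by ring]
    refine h.congr' ?_
    filter_upwards [eventually_pos hσ] with i hi
    have e1 : σ i ^ (p / 2) * σ i ^ (1 + p / 2) = σ i ^ (p + 1) := by
      rw [← Real.rpow_add hi]; congr 1; ring
    rw [← e1]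
    simp only [hDdef, S]
    push_cast; ring
  have hDn : Tendsto (fun i => D i ^ 2 / n i) l
      (𝓝 ((u * Real.Gamma (p + 1) * Complex.I - s) ^ 2 / Real.Gamma p)) := by
    refine ((hD.pow 2).div (hofR (tendsto_rpow_mul_count hp hσ hs))
      (by exact_mod_cast hG.ne')).congr' ?_
    filter_upwards [eventually_pos hσ] with i hi
    have e1 : (σ i ^ (p / 2)) ^ 2 = σ i ^ p := by
      rw [← Real.rpow_natCast, ← Real.rpow_mul hi.le]; congr 1; push_cast; ring
    have e2 : ((σ i ^ p : ℝ) : ℂ) ≠ 0 := by exact_mod_cast (Real.rpow_pos_of_pos hi _).ne'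
    rw [Pi.div_apply, mul_pow, ← Complex.ofReal_pow, e1, Complex.ofReal_mul, Complex.ofReal_natCast,
      mul_div_mul_left _ _ e2]
  refine ((tendsto_one_add_div_pow_mul_cexp hn hDn).mul ((Complex.continuous_exp.tendsto _).comp
    (tendsto_log_partition_integrand hp hσ hN u))).congr' ?_
  filter_upwards [hn.eventually_gt_atTop 0] with i hi
  have hni : (n i : ℂ) ≠ 0 := by exact_mod_cast hi.ne'
  have e1 : 1 + D i / n i = S i / n i := by
    simp only [hDdef]; field_simp; ring
  rw [e1, mul_assoc, Function.comp_apply, ← Complex.exp_add]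
  congr 2
  simp only [hDdef, S]
  ring

theorem integral_count_limit (hp : 0 < p) (s : ℝ) :
    ∫ u : ℝ, Complex.exp (-((u * Real.Gamma (p + 1) * Complex.I - s) ^ 2 / Real.Gamma p / 2)) *
        Complex.exp (-(Real.Gamma (p + 2) * u ^ 2 / 2 : ℝ)) =
      ((√(2 * Real.pi / (p * Real.Gamma p)) *
        Real.exp (-((p + 1) * s ^ 2 / (2 * Real.Gamma p))) : ℝ) : ℂ) := by
  have hG := Real.Gamma_pos_of_pos hp
  set G := Real.Gamma p
  have hG1 : Real.Gamma (p + 1) = p * G := Real.Gamma_add_one hp.ne'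
  have hG2 : Real.Gamma (p + 2) = (p + 1) * (p * G) := by
    rw [show p + 2 = (p + 1) + 1 by ring, Real.Gamma_add_one (by linarith), hG1]
  have hGc : (G : ℂ) ≠ 0 := by exact_mod_cast hG.ne'
  have hpc : (p : ℂ) ≠ 0 := by exact_mod_cast hp.ne'
  have hfun : ∀ u : ℝ, Complex.exp (-((u * Real.Gamma (p + 1) * Complex.I - s) ^ 2 / G / 2)) *
        Complex.exp (-(Real.Gamma (p + 2) * u ^ 2 / 2 : ℝ)) =
      Complex.exp (-(s ^ 2 / (2 * G))) * (Complex.exp (Complex.I * (p * s : ℂ) * u) *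
        Complex.exp (-((p * G / 2 : ℝ) : ℂ) * u ^ 2)) := by
    intro u
    rw [← Complex.exp_add, ← Complex.exp_add, ← Complex.exp_add, hG1, hG2]
    congr 1
    push_cast
    field_simp
    linear_combination (-(u : ℂ) ^ 2 * p ^ 2 * G ^ 2) * Complex.I_sq
  have hb : 0 < p * G / 2 := by positivity
  simp only [hfun]
  rw [integral_const_mul, fourierIntegral_gaussian (by simpa using hb)]
  have hsq : ((Real.pi : ℂ) / ((p * G / 2 : ℝ) : ℂ)) ^ (1 / 2 : ℂ) =
      ((√(2 * Real.pi / (p * G)) : ℝ) : ℂ) := by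
    rw [Real.sqrt_eq_rpow, Complex.ofReal_cpow (by positivity)]
    push_cast
    congr 1
    field_simp
  rw [hsq, mul_left_comm, ← Complex.exp_add, Complex.ofReal_mul, Complex.ofReal_exp]
  congr 2
  push_cast
  field_simp
  ring

theorem integral_partition_limit (hp : 0 < p) :
    ∫ u : ℝ, Complex.exp (-(Real.Gamma (p + 2) * u ^ 2 / 2 : ℝ)) =
      ((√(2 * Real.pi / ((p + 1) * (p * Real.Gamma p))) : ℝ) : ℂ) := by
  have hG2 : Real.Gamma (p + 2) = (p + 1) * (p * Real.Gamma p) := by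
    rw [show p + 2 = (p + 1) + 1 by ring, Real.Gamma_add_one (by linarith),
      Real.Gamma_add_one hp.ne']
  have h := integral_gaussian (Real.Gamma (p + 2) / 2)
  rw [hG2] at h ⊢
  have e : Real.pi / ((p + 1) * (p * Real.Gamma p) / 2) =
      2 * Real.pi / ((p + 1) * (p * Real.Gamma p)) := by
    rw [div_div_eq_mul_div, mul_comm]
  rw [← e, ← h, ← integral_complex_ofReal]
  refine integral_congr_ae (Eventually.of_forall fun u => ?_)
  simp only [Complex.ofReal_exp]
  congr 1
  push_cast; ring

/-- The inequality `x ^ m ≤ e ^ (m (x - 1))` with `x = ‖z‖ / m` removes `m` from the bound. -/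
theorem norm_pow_mul_cexp_le {z : ℂ} {m : ℕ} (hm : 0 < m) (t θ : ℝ) (k : ℕ) :
    ‖(z / m) ^ m * Complex.exp (m - t - k * Complex.I * θ)‖ ≤ Real.exp (‖z‖ - t) := by
  have hm0 : (0 : ℝ) < m := by exact_mod_cast hm
  have h1 : ‖Complex.exp (m - t - k * Complex.I * θ)‖ = Real.exp (m - t) := by
    rw [Complex.norm_exp]; simp
  have h2 : ‖z‖ / m ≤ Real.exp (‖z‖ / m - 1) := by linarith [Real.add_one_le_exp (‖z‖ / m - 1)]
  have h3 := pow_le_pow_left₀ (by positivity) h2 m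
  rw [← Real.exp_nat_mul] at h3
  rw [norm_mul, norm_pow, norm_div, Complex.norm_natCast, h1]
  calc (‖z‖ / m) ^ m * Real.exp (m - t) ≤ Real.exp (m * (‖z‖ / m - 1)) * Real.exp (m - t) := by
        gcongr
    _ = Real.exp (‖z‖ - t) := by
        rw [← Real.exp_add]; congr 1; field_simp; ring

theorem probNumGroups_eq (a : ℕ → ℝ) (N n : ℕ) :
    probNumGroups a N n =
      (∑ η : N.Partition with numGroups η = n, weight a η) / partitionFunction a N := by
  simp only [probNumGroups, equilibriumMass]
  rw [← mul_sum, div_eq_inv_mul]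

theorem partitionFunction_pos {a : ℕ → ℝ} (ha : ∀ k, 1 ≤ k → 0 < a k) (N : ℕ) :
    0 < partitionFunction a N :=
  sum_pos (fun η _ => weight_pos ha η) univ_nonempty

/-- The quotient of the two Fourier integrals: the common factors `2π e ^ (-N σ)`, `e ^ (-S(σ))` and
`σ ^ (1 + p / 2)` cancel, and `n! e ^ n / n ^ n` is left for Stirling's formula. -/
theorem tendsto_factorial_mul_probNumGroups [l.IsCountablyGenerated] (hp : 0 < p)
    (hσ : Tendsto σ l (𝓝[>] 0))
    (hN : ∀ᶠ i in l, (N i : ℝ) = Real.Gamma (p + 1) * σ i ^ (-(p + 1)))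
    (hs : Tendsto (fun i => σ i ^ (p / 2) * (n i - Real.Gamma p * σ i ^ (-p))) l (𝓝 s)) :
    Tendsto (fun i => (n i)! / (n i : ℝ) ^ n i * Real.exp (n i) *
      probNumGroups (powWeight p) (N i) (n i)) l
      (𝓝 (√(p + 1) * Real.exp (-((p + 1) * s ^ 2 / (2 * Real.Gamma p))))) := by
  have hG := Real.Gamma_pos_of_pos hp
  have hpi := Real.pi_pos
  have hn := (tendsto_count_atTop hp hσ hs).eventually_gt_atTop 0
  have hpos := eventually_pos hσ
  have ha := powWeight_pos p
  have hA := tendsto_integral_of_norm_le hp hσ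
    (H := fun i θ => (genFun (powWeight p) (σ i - θ * Complex.I) / n i) ^ n i *
        Complex.exp (n i - expSum p (σ i) - N i * Complex.I * θ))
    (by
      filter_upwards [hpos] with i hi
      have := continuous_genFun _ ha (summable_powWeight p hi)
      fun_prop)
    (by
      filter_upwards [hn] with i hi θ
      exact norm_pow_mul_cexp_le hi _ _ _)
    (tendsto_count_integrand hp hσ hN hs)
  have hC := tendsto_integral_of_norm_le hp hσ
    (H := fun i θ => Complex.exp (genFun (powWeight p) (σ i - θ * Complex.I)
        - expSum p (σ i) - N i * Complex.I * θ))
    (by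
      filter_upwards [hpos] with i hi
      have := continuous_genFun _ ha (summable_powWeight p hi)
      fun_prop)
    (by
      refine Eventually.of_forall fun i θ => ?_
      rw [Complex.norm_exp]
      refine Real.exp_le_exp.2 ?_
      have := Complex.re_le_norm (genFun (powWeight p) (σ i - θ * Complex.I))
      simpa using this)
    (fun u => (Complex.continuous_exp.tendsto _).comp (tendsto_log_partition_integrand hp hσ hN u))
  rw [integral_count_limit hp] at hA
  rw [integral_partition_limit hp] at hC
  have hne : ((√(2 * Real.pi / ((p + 1) * (p * Real.Gamma p))) : ℝ) : ℂ) ≠ 0 := by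
    exact_mod_cast (Real.sqrt_pos.2 (by positivity)).ne'
  have hq := (Complex.continuous_re.tendsto _).comp (hA.div hC hne)
  have hval : √(2 * Real.pi / (p * Real.Gamma p)) / √(2 * Real.pi / ((p + 1) * (p * Real.Gamma p)))
      = √(p + 1) := by
    rw [← Real.sqrt_div (by positivity)]
    congr 1
    field_simp
  rw [← Complex.ofReal_div, Complex.ofReal_re, mul_div_right_comm, hval] at hq
  refine hq.congr' ?_
  filter_upwards [hpos, hn] with i hi hni
  have hIA : ∫ θ in (-Real.pi)..Real.pi, (genFun (powWeight p) (σ i - θ * Complex.I) / n i) ^ n i *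
        Complex.exp (n i - expSum p (σ i) - N i * Complex.I * θ) =
      (((n i)! / (n i : ℝ) ^ n i * Real.exp (n i - expSum p (σ i)) *
        (2 * Real.pi * Real.exp (-(N i * σ i)) *
        (∑ η : (N i).Partition with numGroups η = n i, weight (powWeight p) η)) : ℝ) : ℂ) := by
    have h := integral_genFun_pow (powWeight p) ha (summable_powWeight p hi) (N i) (n i)
    rw [Complex.ofReal_mul, Complex.ofReal_mul (2 * Real.pi * _), Complex.ofReal_mul (2 * Real.pi),
      Complex.ofReal_mul 2, Complex.ofReal_ofNat, ← h, ← intervalIntegral.integral_const_mul]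
    refine intervalIntegral.integral_congr fun θ _ => ?_
    have hf : ((n i)! : ℂ) ≠ 0 := by exact_mod_cast Nat.factorial_ne_zero _
    rw [sub_eq_add_neg _ ((N i : ℂ) * Complex.I * θ), Complex.exp_add, div_pow]
    push_cast
    field_simp
  have hIC : ∫ θ in (-Real.pi)..Real.pi, Complex.exp (genFun (powWeight p) (σ i - θ * Complex.I)
        - expSum p (σ i) - N i * Complex.I * θ) =
      ((Real.exp (-expSum p (σ i)) * (2 * Real.pi * Real.exp (-(N i * σ i)) *
        partitionFunction (powWeight p) (N i)) : ℝ) : ℂ) := by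
    have h := integral_exp_genFun (powWeight p) ha (summable_powWeight p hi) (N i)
    rw [Complex.ofReal_mul, Complex.ofReal_mul (2 * Real.pi * _), Complex.ofReal_mul (2 * Real.pi),
      Complex.ofReal_mul 2, Complex.ofReal_ofNat, ← h, ← intervalIntegral.integral_const_mul]
    refine intervalIntegral.integral_congr fun θ _ => ?_
    rw [← Complex.exp_add, Complex.ofReal_exp, ← Complex.exp_add]
    congr 1
    push_cast; ring
  have hρ : ((σ i ^ (1 + p / 2) : ℝ) : ℂ)⁻¹ ≠ 0 :=
    inv_ne_zero (by exact_mod_cast (Real.rpow_pos_of_pos hi _).ne')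
  simp only [Function.comp_apply, Pi.div_apply]
  rw [mul_div_mul_left _ _ hρ, hIA, hIC, ← Complex.ofReal_div, Complex.ofReal_re, probNumGroups_eq,
    sub_eq_add_neg (n i : ℝ), Real.exp_add]
  have hc := (partitionFunction_pos ha (N i)).ne'
  have := (Real.exp_pos (-expSum p (σ i))).ne'
  have := (Real.exp_pos (-(N i * σ i))).ne'
  field_simp

/-- The local limit theorem along a filter, in terms of the scale `σ`. The limit is Gaussian with
variance `Γ(p) / (p + 1)` in the variable `s`. -/
theorem tendsto_sqrt_mul_probNumGroups [l.IsCountablyGenerated] (hp : 0 < p)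
    (hσ : Tendsto σ l (𝓝[>] 0))
    (hN : ∀ᶠ i in l, (N i : ℝ) = Real.Gamma (p + 1) * σ i ^ (-(p + 1)))
    (hs : Tendsto (fun i => σ i ^ (p / 2) * (n i - Real.Gamma p * σ i ^ (-p))) l (𝓝 s)) :
    Tendsto (fun i => √(2 * Real.pi * n i) * probNumGroups (powWeight p) (N i) (n i)) l
      (𝓝 (√(p + 1) * Real.exp (-((p + 1) * s ^ 2 / (2 * Real.Gamma p))))) := by
  have hn := tendsto_count_atTop hp hσ hs
  have hst := ((Asymptotics.isEquivalent_iff_tendsto_one (Eventually.of_forall fun m => by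
    exact_mod_cast Nat.factorial_ne_zero m)).1
      Stirling.factorial_isEquivalent_stirling.symm).comp hn
  have h := hst.mul (tendsto_factorial_mul_probNumGroups hp hσ hN hs)
  rw [one_mul] at h
  refine h.congr' ?_
  filter_upwards [hn.eventually_gt_atTop 0] with i hi
  have hf : ((n i)! : ℝ) ≠ 0 := by exact_mod_cast Nat.factorial_ne_zero _
  have hni : (n i : ℝ) ≠ 0 := by exact_mod_cast hi.ne'
  simp only [Function.comp_apply, Pi.div_apply]
  rw [div_pow, ← Real.exp_nat_mul, mul_one, mul_right_comm 2]
  have := (Real.exp_pos (n i)).ne'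
  field_simp

/-- The scale `σ` with `N = Γ(p + 1) σ ^ (-(p + 1))`. -/
noncomputable def scale (p : ℝ) (N : ℕ) : ℝ := (Real.Gamma (p + 1) / N) ^ (1 / (p + 1))

theorem scale_pos (hp : 0 < p) {N : ℕ} (hN : 0 < N) : 0 < scale p N := by
  have : (0 : ℝ) < N := by exact_mod_cast hN
  have := Real.Gamma_pos_of_pos (show 0 < p + 1 by linarith)
  unfold scale
  positivity

theorem scale_rpow (hp : 0 < p) {N : ℕ} (hN : 0 < N) (r : ℝ) :
    scale p N ^ r = Real.Gamma (p + 1) ^ (r / (p + 1)) * (N : ℝ) ^ (-(r / (p + 1))) := by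
  have hN' : (0 : ℝ) < N := by exact_mod_cast hN
  have hG := Real.Gamma_pos_of_pos (show 0 < p + 1 by linarith)
  unfold scale
  rw [← Real.rpow_mul (by positivity), one_div_mul_eq_div, Real.div_rpow hG.le hN'.le,
    Real.rpow_neg hN'.le, div_eq_mul_inv]

theorem tendsto_scale (hp : 0 < p) (hN : Tendsto N l atTop) :
    Tendsto (fun i => scale p (N i)) l (𝓝[>] 0) := by
  refine tendsto_nhdsWithin_iff.2 ⟨?_, ?_⟩
  · have h1 : Tendsto (fun i => Real.Gamma (p + 1) / (N i : ℝ)) l (𝓝 0) :=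
      tendsto_const_nhds.div_atTop (tendsto_natCast_atTop_atTop.comp hN)
    have h2 := (Real.continuousAt_rpow_const 0 (1 / (p + 1))
      (Or.inr (by positivity))).tendsto.comp h1
    rwa [Real.zero_rpow (by positivity)] at h2
  · filter_upwards [hN.eventually_gt_atTop 0] with i hi using scale_pos hp hi

theorem Gamma_mul_scale_rpow (hp : 0 < p) {N : ℕ} (hN : 0 < N) :
    Real.Gamma p * scale p N ^ (-p) = Q p * (N : ℝ) ^ (p / (p + 1)) := by
  have hG := Real.Gamma_pos_of_pos (show 0 < p + 1 by linarith)
  have h1 : Real.Gamma p = p⁻¹ * Real.Gamma (p + 1) := by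
    rw [Real.Gamma_add_one hp.ne', inv_mul_cancel_left₀ hp.ne']
  have h2 : Real.Gamma (p + 1) * Real.Gamma (p + 1) ^ (-p / (p + 1)) =
      Real.Gamma (p + 1) ^ (1 / (p + 1)) := by
    nth_rw 1 [← Real.rpow_one (Real.Gamma (p + 1))]
    rw [← Real.rpow_add hG]
    congr 1; field_simp; ring
  rw [scale_rpow hp hN, h1, Q, ← h2, neg_div, neg_neg]
  ring

theorem Q_mul_rpow (hp : 0 < p) :
    Q p * (Real.Gamma (p + 1) ^ (p / (2 * p + 2))) ^ 2 = Real.Gamma p := by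
  have hG := Real.Gamma_pos_of_pos (show 0 < p + 1 by linarith)
  have h1 : Real.Gamma p = p⁻¹ * Real.Gamma (p + 1) := by
    rw [Real.Gamma_add_one hp.ne', inv_mul_cancel_left₀ hp.ne']
  rw [Q, mul_assoc, ← Real.rpow_natCast, ← Real.rpow_mul hG.le, ← Real.rpow_add hG, h1]
  have : 1 / (p + 1) + p / (2 * p + 2) * (2 : ℕ) = 1 := by
    push_cast; field_simp; ring
  rw [this, Real.rpow_one]

/-- The local limit theorem along a sequence for which the rescaled deviation converges. -/
theorem tendsto_probNumGroups_div_localDensity [l.IsCountablyGenerated] (hp : 0 < p)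
    (hN : Tendsto N l atTop) {t : ι → ℝ} (ht : Tendsto t l (𝓝 s))
    (hn : ∀ i, (n i : ℝ) = Q p * (N i : ℝ) ^ (p / (p + 1)) + t i * (N i : ℝ) ^ (p / (2 * p + 2))) :
    Tendsto (fun i => probNumGroups (powWeight p) (N i) (n i) / localDensity p (N i) (t i)) l
      (𝓝 1) := by
  have hG := Real.Gamma_pos_of_pos hp
  have hG1 := Real.Gamma_pos_of_pos (show 0 < p + 1 by linarith)
  have hQ : 0 < Q p := by unfold Q; positivity
  have hd : 0 < d p := by unfold d; positivity
  have hpi := Real.pi_pos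
  set κ := Real.Gamma (p + 1) ^ (p / (2 * p + 2)) with hκ
  have hσ := tendsto_scale hp hN
  have hN0 := hN.eventually_gt_atTop 0
  have hNσ : ∀ᶠ i in l, (N i : ℝ) = Real.Gamma (p + 1) * scale p (N i) ^ (-(p + 1)) := by
    filter_upwards [hN0] with i hi
    rw [scale_rpow hp hi, neg_div, div_self (by positivity), neg_neg, Real.rpow_one,
      Real.rpow_neg_one, mul_inv_cancel_left₀ hG1.ne']
  have hs : Tendsto (fun i => scale p (N i) ^ (p / 2) *
      (n i - Real.Gamma p * scale p (N i) ^ (-p))) l (𝓝 (κ * s)) := by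
    refine (ht.const_mul κ).congr' ?_
    filter_upwards [hN0] with i hi
    have hNi : (0 : ℝ) < N i := by exact_mod_cast hi
    have e : p / 2 / (p + 1) = p / (2 * p + 2) := by field_simp
    have e2 : (N i : ℝ) ^ (-(p / (2 * p + 2))) * (N i : ℝ) ^ (p / (2 * p + 2)) = 1 := by
      rw [← Real.rpow_add hNi]; simp
    rw [hn, Gamma_mul_scale_rpow hp hi, add_sub_cancel_left, scale_rpow hp hi, e]
    linear_combination (-κ * t i) * e2
  have hlim := tendsto_sqrt_mul_probNumGroups hp hσ hNσ hs
  have hcount := tendsto_rpow_mul_count hp hσ hs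
  have hratio : Tendsto (fun i => √(Real.Gamma p / ((p + 1) * (scale p (N i) ^ p * n i)))) l
      (𝓝 (√(p + 1))⁻¹) := by
    have h := ((tendsto_const_nhds (x := Real.Gamma p)).div (hcount.const_mul (p + 1))
      (by positivity)).sqrt
    rwa [div_mul_cancel_right₀ hG.ne', Real.sqrt_inv] at h
  have hexp : Tendsto (fun i => Real.exp (t i ^ 2 / (2 * d p))) l
      (𝓝 (Real.exp (s ^ 2 / (2 * d p)))) :=
    (Real.continuous_exp.tendsto _).comp ((ht.pow 2).div_const _)
  have h := (hlim.mul hratio).mul hexp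
  have hone : √(p + 1) * Real.exp (-((p + 1) * (κ * s) ^ 2 / (2 * Real.Gamma p))) * (√(p + 1))⁻¹ *
      Real.exp (s ^ 2 / (2 * d p)) = 1 := by
    have e1 : (p + 1) * (κ * s) ^ 2 / (2 * Real.Gamma p) = s ^ 2 / (2 * d p) := by
      have hκ0 : 0 < κ := by positivity
      rw [← Q_mul_rpow hp, ← hκ, d]
      field_simp
    have e2 : √(p + 1) ≠ 0 := (Real.sqrt_pos.2 (by linarith)).ne'
    rw [e1, mul_right_comm _ _ (√(p + 1))⁻¹, mul_inv_cancel₀ e2, one_mul, ← Real.exp_add,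
      neg_add_cancel, Real.exp_zero]
  rw [hone] at h
  refine h.congr' ?_
  filter_upwards [hN0, (tendsto_count_atTop hp hσ hs).eventually_gt_atTop 0] with i hi hni
  have hNi : (0 : ℝ) < N i := by exact_mod_cast hi
  have hni' : (0 : ℝ) < n i := by exact_mod_cast hni
  have hσi := scale_pos hp hi
  have e0 : Real.Gamma p / ((p + 1) * (scale p (N i) ^ p * n i)) =
      d p * (N i : ℝ) ^ (p / (p + 1)) / n i := by
    rw [d, div_mul_eq_mul_div, ← Gamma_mul_scale_rpow hp hi, Real.rpow_neg hσi.le]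
    have := (Real.rpow_pos_of_pos hσi p).ne'
    field_simp
  have e1 : √((N i : ℝ) ^ (p / (p + 1))) = (N i : ℝ) ^ (p / (2 * p + 2)) := by
    rw [Real.sqrt_eq_rpow, ← Real.rpow_mul hNi.le]
    congr 1; field_simp
  have e2 : √(2 * Real.pi * n i) * √(d p * (N i : ℝ) ^ (p / (p + 1)) / n i) =
      √(2 * Real.pi * d p) * (N i : ℝ) ^ (p / (2 * p + 2)) := by
    rw [← Real.sqrt_mul (by positivity), ← e1, ← Real.sqrt_mul (by positivity)]
    congr 1; field_simp
  have e3 : √(2 * Real.pi * d p) ≠ 0 := (Real.sqrt_pos.2 (by positivity)).ne'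
  rw [e0, mul_right_comm (√(2 * Real.pi * n i)), e2, localDensity, Real.rpow_neg hNi.le,
    Real.exp_neg]
  have := (Real.exp_pos (t i ^ 2 / (2 * d p))).ne'
  have := (Real.rpow_pos_of_pos hNi (p / (2 * p + 2))).ne'
  field_simp

end LocalLimit

end CoagFrag

theorem theorem4p5 (p : ℝ) (hp : 0 < p) (K : ℝ) (ε : ℝ) (hε : 0 < ε) :
    ∀ᶠ N : ℕ in Filter.atTop, ∀ (n : ℕ) (s : ℝ), |s| ≤ K →
      (n : ℝ) = CoagFrag.Q p * (N : ℝ) ^ (p / (p + 1)) + s * (N : ℝ) ^ (p / (2 * p + 2)) →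
      |CoagFrag.probNumGroups (fun k => (k : ℝ) ^ (p - 1)) N n / CoagFrag.localDensity p N s - 1|
        < ε := by
  -- otherwise there are counterexamples along some sequence, and along a subsequence `s` converges
  by_contra hcon
  rw [Filter.not_eventually] at hcon
  obtain ⟨f, hf, hbad⟩ := Filter.extraction_of_frequently_atTop hcon
  push Not at hbad
  choose n t ht hn hge using hbad
  obtain ⟨s, -, g, hg, hs⟩ := (isCompact_Icc (a := -K) (b := K)).tendsto_subseq
    (fun i => abs_le.1 (ht i))
  have h := CoagFrag.tendsto_probNumGroups_div_localDensity hp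
    (hf.tendsto_atTop.comp hg.tendsto_atTop) hs (n := n ∘ g) (fun i => hn (g i))
  have h1 := (h.sub_const 1).abs
  rw [sub_self, abs_zero] at h1
  obtain ⟨i, hi⟩ := (h1.eventually_lt_const hε).exists
  exact absurd hi (not_lt.2 (hge (g i)))
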